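/- **Theorem 3.11 (Ito formula – product form).** Let $(S_t)_{t\ge 0}$ be a free Brownian motion. That is: $\mathcal A$ is a von Neumann algebra with a faithful normal tracial state $\tau$; $(\mathcal A_t)_{t\ge0}$ are von Neumann subalgebras of $\mathcal A$ with $\mathcal A_s\subset\mathcal A_t$ for $s\le t$; for every $t\ge 0$ one has $S_t=S_t^*\in\mathcal A_t$ and $S_t$ has the semicircle distribution with mean $0$ and variance $t$ with respect to $\tau$ (the point mass at $0$ for $t=0$); and for all $0\le s<t$ the increment $S_t-S_s$ is free from $\mathcal A_s$ and has the semicircle distribution with mean $0$ and variance $t-s$. (Free means: $\tau[a_1\cdots a_k]=0$ for every $k\ge1$ whenever the $a_i$ lie alternatingly in the unital algebra generated by $S_t-S_s$ and in $\mathcal A_s$, and $\tau[a_i]=0$ for all $i$.) For an interval $[s,t)$ put $S([s,t)):=S_t-S_s$. Then $dS_t\,A\,dS_t=\tau[A]\,dt$ for $A\in\mathcal A_t$, in the following sense. Let $0\le a\le b<\infty$, $I=[a,b)$, and $A\in\mathcal A_a$. Then $$\sum_i S(I_i)\,A\,S(I_i)\longrightarrow \tau[A]\,(b-a)\,1$$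 in operator norm as the width $\max_i\lambda(I_i)$ ($\lambda$ is Lebesgue measure) of the decomposition of $I$ into finitely many disjoint intervals $I_i=[t_{i-1},t_i)$, $a=t_0\le t_1\le\dots\le t_n=b$, tends to zero. That is, for every $\varepsilon>0$ there is $\delta>0$ such that $\bigl\|\sum_{i=1}^n S(I_i)AS(I_i)-\tau[A](b-a)1\bigr\|<\varepsilon$ for every such decomposition with $\max_i\lambda(I_i)<\delta$. -/

import Mathlib

open MeasureTheory
open scoped NNReal

namespace FreeCalculus

/-- The semicircle distribution on `ℝ` with mean `0` and variance `v`: the point mass at `0` when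
`v = 0`, and otherwise the measure with density `√(4 v - x ^ 2) / (2 π v)`. As `Real.sqrt` vanishes
at negative arguments, the density is supported on `[-2 √v, 2 √v]`. -/
noncomputable def semicircle (v : ℝ≥0) : Measure ℝ :=
  if v = 0 then Measure.dirac 0
  else volume.withDensity
    fun x : ℝ => ENNReal.ofReal (Real.sqrt (4 * (v : ℝ) - x ^ 2) / (2 * Real.pi * (v : ℝ)))

section Freeness

variable {A : Type*} [Ring A] [Algebra ℂ A]

/-- Freeness of a family of unital subalgebras `B i` of a non-commutative probability space
`(A, φ)`: `φ (a₁ ⋯ aₖ) = 0` for all `k ≥ 1` and all `aᵢ ∈ B (j i)` with `φ (aᵢ) = 0` such that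
neighbouring indices `j i` and `j (i + 1)` are different. A word is a list of pairs `(j i, aᵢ)`. -/
def Free (φ : A →ₗ[ℂ] ℂ) {ι : Type*} (B : ι → Subalgebra ℂ A) : Prop :=
  ∀ w : List (ι × A), w ≠ [] →
    w.IsChain (fun p q => p.1 ≠ q.1) →
    (∀ p ∈ w, p.2 ∈ B p.1) →
    (∀ p ∈ w, φ p.2 = 0) →
    φ (w.map Prod.snd).prod = 0

/-- The random variable `x` is free from the unital subalgebra `B`: the unital algebra generated by
`x` and `B` are free. -/
def FreeFrom (φ : A →ₗ[ℂ] ℂ) (x : A) (B : Subalgebra ℂ A) : Prop :=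
  Free φ ![Algebra.adjoin ℂ {x}, B]

/-- The random variable `x` has the compactly supported distribution `μ` with respect to `φ`. Such
a distribution is determined by its moments. -/
def HasDistribution (φ : A →ₗ[ℂ] ℂ) (x : A) (μ : Measure ℝ) : Prop :=
  ∀ n : ℕ, φ (x ^ n) = ((∫ y : ℝ, y ^ n ∂μ : ℝ) : ℂ)

end Freeness

section BrownianMotion

variable {H : Type*} [NormedAddCommGroup H] [InnerProductSpace ℂ H] [CompleteSpace H]

/-- `τ` is a faithful normal tracial state on the von Neumann algebra `M`. Positive elements and
suprema refer to the usual (Loewner) order of operators. -/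
structure IsFaithfulNormalTracialState (M : VonNeumannAlgebra H)
    (τ : M.toStarSubalgebra →ₗ[ℂ] ℂ) : Prop where
  map_one : τ 1 = 1
  re_nonneg : ∀ x : M.toStarSubalgebra, 0 ≤ (τ (star x * x)).re
  im_eq_zero : ∀ x : M.toStarSubalgebra, (τ (star x * x)).im = 0
  faithful : ∀ x : M.toStarSubalgebra, τ (star x * x) = 0 → x = 0
  tracial : ∀ x y : M.toStarSubalgebra, τ (x * y) = τ (y * x)
  /-- Normality: `τ` preserves the suprema of bounded upward directed families of positive
  elements. -/
  normal : ∀ (D : Set M.toStarSubalgebra) (x : M.toStarSubalgebra), D.Nonempty →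
    (∀ d ∈ D, (0 : H →L[ℂ] H) ≤ d) →
    DirectedOn (fun d e : M.toStarSubalgebra => (d : H →L[ℂ] H) ≤ e) D →
    (∀ d ∈ D, (d : H →L[ℂ] H) ≤ x) →
    (∀ y : M.toStarSubalgebra, (∀ d ∈ D, (d : H →L[ℂ] H) ≤ y) → (x : H →L[ℂ] H) ≤ y) →
    IsLUB ((fun d => (τ d).re) '' D) (τ x).re

/-- The operators in `M` that belong to the von Neumann algebra `N`, as a unital subalgebra of
`M`. -/
noncomputable def subalgebraIn (M N : VonNeumannAlgebra H) : Subalgebra ℂ M.toStarSubalgebra :=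
  N.toStarSubalgebra.toSubalgebra.comap M.toStarSubalgebra.toSubalgebra.val

/-- `S` is a free Brownian motion in the von Neumann algebra `M` with faithful normal tracial state
`τ`, with respect to the filtration `F`. -/
structure IsFreeBrownianMotion (M : VonNeumannAlgebra H) (τ : M.toStarSubalgebra →ₗ[ℂ] ℂ)
    (F : ℝ≥0 → VonNeumannAlgebra H) (S : ℝ≥0 → M.toStarSubalgebra) : Prop where
  state : IsFaithfulNormalTracialState M τ
  filtration_le : ∀ t, F t ≤ M
  filtration_mono : ∀ s t, s ≤ t → F s ≤ F t
  adapted : ∀ t, (S t : H →L[ℂ] H) ∈ F t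
  selfAdjoint : ∀ t, star (S t) = S t
  distribution : ∀ t, HasDistribution τ (S t) (semicircle t)
  increment_free : ∀ s t, s < t → FreeFrom τ (S t - S s) (subalgebraIn M (F s))
  increment_distribution : ∀ s t, s < t → HasDistribution τ (S t - S s) (semicircle (t - s))

end BrownianMotion

end FreeCalculus

/-!
Write each increment as `X i = l i + l i⋆`, a sum of a free creation and a free annihilation
operator with `l i⋆ b l j = δᵢⱼ τ(b) v i` for `b` in the algebra generated by `A`, `A⋆`. In the
expansion of `∑ X i A X i` the terms `l i⋆ A l i` sum to `τ(A) (b - a)` exactly. The three other sums are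
small in norm: `∑ l i A l i⋆` is at most `max v i ‖A‖` as the `l i` have orthogonal ranges, while
`∑ l i A l i` and `∑ l i⋆ A l i⋆` are at most `√(∑ (v i)²) ‖A‖`
(`IsCreation.norm_quadratic_sum_sub_le`).

No Fock space is needed for this. The operators act on the free algebra in letters for `A`, `A⋆` and
the `X i`, with the degenerate inner product `τ(U⋆ V)`. The annihilation operator `l i⋆` is
`v i (τ ⊗ id) ∘ ∂ i`, where `∂ i` is the free difference quotient (`annih`), and `l i` is
multiplication by `X i` minus `l i⋆`. That these operators are adjoint to each other and satisfy the
relations above follows from the Schwinger-Dyson equation `τ(X i W) = v i (τ ⊗ τ)(∂ i W)`. It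
holds for a semicircular variable that is free from the other letters (`SchwingerDyson.of_free`,
with the Catalan recursion of the semicircle moments as input). As `X i` is only known to be free from
the past, the equation is carried over to words with later increments one increment at a time
(`SchwingerDyson.of_agree`), which uses the trace property and coassociativity of the difference
quotients.

The estimates hold in the seminorm of `τ`, on a subalgebra that need not be dense. A faithful trace
turns them into operator norm estimates by way of the moments of `T⋆ T`
(`norm_le_of_seminorm_le`).
-/

namespace FreeCalculus

/-! ### Annihilation operators on a free algebra -/

section Annihilation

variable {α : Type*} [DecidableEq α]

/-- The action of the letter `l` on pairs `(h, W)`, where `W` is an element of the free algebra and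
`h` sends a functional `ψ` to an element of it. If `h ψ = ∑ ψ (P) Q` over the factorizations
`W = P * x * Q` at occurrences of `x`, then the first component of the image is the same sum for
`l * W`. -/
noncomputable def splitStep (x l : α) :
    Module.End ℂ ((Module.Dual ℂ (FreeAlgebra ℂ α) →ₗ[ℂ] FreeAlgebra ℂ α) × FreeAlgebra ℂ α) :=
  LinearMap.prod
    (LinearMap.coprod
      (LinearMap.lcomp ℂ (FreeAlgebra ℂ α) (LinearMap.mulLeft ℂ (FreeAlgebra.ι ℂ l)).dualMap)
      (if l = x then
        LinearMap.smulRightₗ (Module.Dual.eval ℂ (FreeAlgebra ℂ α) 1) else 0))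
    (LinearMap.mulLeft ℂ (FreeAlgebra.ι ℂ l) ∘ₗ LinearMap.snd ℂ _ _)

/-- The annihilation operator of the letter `x` weighted by the functional `ψ`: on a word `U` it is
`∑ ψ (P) Q`, the sum running over the factorizations `U = P * x * Q`. Thus
`annih x ψ = (ψ ⊗ id) ∘ ∂ₓ` with `∂ₓ` the free difference quotient. Keeping `ψ` as a parameter makes
the Leibniz rule `annih_mul` and the coassociativity `annih_annih` expressible without tensor
products. -/
noncomputable def annih (x : α) (ψ : Module.Dual ℂ (FreeAlgebra ℂ α)) :
    FreeAlgebra ℂ α →ₗ[ℂ] FreeAlgebra ℂ α where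
  toFun U := (FreeAlgebra.lift ℂ (splitStep x) U (0, 1)).1 ψ
  map_add' U V := by simp
  map_smul' c U := by simp

theorem splitStep_apply (x l : α) (h : Module.Dual ℂ (FreeAlgebra ℂ α) →ₗ[ℂ] FreeAlgebra ℂ α)
    (W : FreeAlgebra ℂ α) (ψ : Module.Dual ℂ (FreeAlgebra ℂ α)) :
    (splitStep x l (h, W)).1 ψ = (if l = x then ψ 1 • W else 0)
      + h (ψ ∘ₗ LinearMap.mulLeft ℂ (FreeAlgebra.ι ℂ l)) := by
  unfold splitStep
  split_ifs with hl
  · simp [add_comm]; rfl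
  · simp; rfl

theorem lift_splitStep_snd (x : α) (U : FreeAlgebra ℂ α)
    (p : (Module.Dual ℂ (FreeAlgebra ℂ α) →ₗ[ℂ] FreeAlgebra ℂ α) × FreeAlgebra ℂ α) :
    (FreeAlgebra.lift ℂ (splitStep x) U p).2 = U * p.2 := by
  induction U using FreeAlgebra.induction generalizing p with
  | grade0 r => simp [Algebra.algebraMap_eq_smul_one]
  | grade1 l => simp [splitStep]
  | mul a b ha hb => simp [ha, hb, mul_assoc]
  | add a b ha hb => simp [ha, hb, add_mul]

theorem annih_ι (x l : α) (ψ : Module.Dual ℂ (FreeAlgebra ℂ α)) :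
    annih x ψ (FreeAlgebra.ι ℂ l) = if l = x then ψ 1 • 1 else 0 := by
  show (FreeAlgebra.lift ℂ (splitStep x) (FreeAlgebra.ι ℂ l) (0, 1)).1 ψ = _
  rw [FreeAlgebra.lift_ι_apply, splitStep_apply]
  simp

theorem annih_algebraMap (x : α) (ψ : Module.Dual ℂ (FreeAlgebra ℂ α)) (c : ℂ) :
    annih x ψ (algebraMap ℂ _ c) = 0 := by
  show (FreeAlgebra.lift ℂ (splitStep x) (algebraMap ℂ _ c) (0, 1)).1 ψ = _
  simp [Algebra.algebraMap_eq_smul_one]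

@[simp]
theorem annih_one (x : α) (ψ : Module.Dual ℂ (FreeAlgebra ℂ α)) : annih x ψ 1 = 0 := by
  simpa using annih_algebraMap x ψ 1

theorem lift_splitStep_fst (x : α) (U : FreeAlgebra ℂ α)
    (h : Module.Dual ℂ (FreeAlgebra ℂ α) →ₗ[ℂ] FreeAlgebra ℂ α) (W : FreeAlgebra ℂ α)
    (ψ : Module.Dual ℂ (FreeAlgebra ℂ α)) :
    (FreeAlgebra.lift ℂ (splitStep x) U (h, W)).1 ψ
      = annih x ψ U * W + h (ψ ∘ₗ LinearMap.mulLeft ℂ U) := by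
  induction U using FreeAlgebra.induction generalizing h W ψ with
  | grade0 r =>
    have : ψ ∘ₗ LinearMap.mulLeft ℂ (algebraMap ℂ (FreeAlgebra ℂ α) r) = r • ψ := by
      ext Y; simp [Algebra.algebraMap_eq_smul_one]
    rw [annih_algebraMap, this]
    simp [Algebra.algebraMap_eq_smul_one]
  | grade1 l =>
    rw [annih_ι, FreeAlgebra.lift_ι_apply, splitStep_apply]
    split_ifs <;> simp
  | mul a b ha hb =>
    have key : ∀ q : (Module.Dual ℂ (FreeAlgebra ℂ α) →ₗ[ℂ] FreeAlgebra ℂ α) × FreeAlgebra ℂ α,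
        (FreeAlgebra.lift ℂ (splitStep x) (a * b) q).1 ψ
          = annih x ψ a * (b * q.2) + (annih x (ψ ∘ₗ LinearMap.mulLeft ℂ a) b * q.2
            + q.1 (ψ ∘ₗ LinearMap.mulLeft ℂ (a * b))) := by
      rintro ⟨k, Z⟩
      have e : FreeAlgebra.lift ℂ (splitStep x) (a * b) (k, Z)
          = FreeAlgebra.lift ℂ (splitStep x) a (FreeAlgebra.lift ℂ (splitStep x) b (k, Z)) := by
        simp
      rw [e, ← Prod.mk.eta (p := FreeAlgebra.lift ℂ (splitStep x) b (k, Z)), ha, hb,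
        lift_splitStep_snd]
      congr 3
      ext Y; simp
    have h2 : annih x ψ (a * b) = annih x ψ a * b + annih x (ψ ∘ₗ LinearMap.mulLeft ℂ a) b := by
      have h := key (0, 1)
      simp only [mul_one, LinearMap.zero_apply, add_zero] at h
      exact h
    rw [key, h2, add_mul, mul_assoc, add_assoc]
  | add a b ha hb =>
    have : ψ ∘ₗ LinearMap.mulLeft ℂ (a + b)
        = ψ ∘ₗ LinearMap.mulLeft ℂ a + ψ ∘ₗ LinearMap.mulLeft ℂ b := by
      ext Y; simp [add_mul]
    rw [this]
    simp [ha, hb, add_mul]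
    abel

/-- The Leibniz rule. In the second summand `U` is absorbed into the functional. -/
theorem annih_mul (x : α) (ψ : Module.Dual ℂ (FreeAlgebra ℂ α)) (U V : FreeAlgebra ℂ α) :
    annih x ψ (U * V) = annih x ψ U * V + annih x (ψ ∘ₗ LinearMap.mulLeft ℂ U) V := by
  show (FreeAlgebra.lift ℂ (splitStep x) (U * V) (0, 1)).1 ψ = _
  rw [map_mul, Module.End.mul_apply, ← Prod.mk.eta (p := FreeAlgebra.lift ℂ (splitStep x) V (0, 1)),
    lift_splitStep_fst, lift_splitStep_snd, mul_one]
  rfl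

theorem annih_dual_add (x : α) (ψ χ : Module.Dual ℂ (FreeAlgebra ℂ α)) (U : FreeAlgebra ℂ α) :
    annih x (ψ + χ) U = annih x ψ U + annih x χ U :=
  map_add (FreeAlgebra.lift ℂ (splitStep x) U (0, 1)).1 ψ χ

theorem annih_dual_smul (x : α) (c : ℂ) (ψ : Module.Dual ℂ (FreeAlgebra ℂ α))
    (U : FreeAlgebra ℂ α) : annih x (c • ψ) U = c • annih x ψ U :=
  map_smul (FreeAlgebra.lift ℂ (splitStep x) U (0, 1)).1 c ψ

/-- Coassociativity of the free difference quotients. -/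
theorem annih_annih (x y : α) (ψ χ : Module.Dual ℂ (FreeAlgebra ℂ α)) (U : FreeAlgebra ℂ α) :
    annih x ψ (annih y χ U) = annih x (ψ ∘ₗ annih y χ) U := by
  induction U using FreeAlgebra.induction generalizing ψ χ with
  | grade0 r => simp [annih_algebraMap]
  | grade1 l =>
    rw [annih_ι, annih_ι]
    split_ifs <;> simp
  | mul a b ha hb =>
    have : (ψ ∘ₗ annih y χ) ∘ₗ LinearMap.mulLeft ℂ a
        = ψ ∘ₗ LinearMap.mulLeft ℂ (annih y χ a)
          + ψ ∘ₗ annih y (χ ∘ₗ LinearMap.mulLeft ℂ a) := by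
      ext Y; simp [annih_mul]
    rw [annih_mul, map_add, annih_mul, annih_mul, this, annih_dual_add, ha, hb, add_assoc]
  | add a b ha hb => simp [ha, hb]

theorem annih_eq_zero_of_mem_adjoin {x : α} {s : Set α} (hx : x ∉ s)
    (ψ : Module.Dual ℂ (FreeAlgebra ℂ α)) {P : FreeAlgebra ℂ α}
    (hP : P ∈ Algebra.adjoin ℂ (FreeAlgebra.ι ℂ '' s)) : annih x ψ P = 0 := by
  induction hP using Algebra.adjoin_induction generalizing ψ with
  | mem P h =>
    obtain ⟨l, hl, rfl⟩ := h
    rw [annih_ι, if_neg]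
    rintro rfl
    exact hx hl
  | algebraMap r => exact annih_algebraMap x ψ r
  | add a b _ _ ha hb => rw [map_add, ha, hb, add_zero]
  | mul a b _ _ ha hb => rw [annih_mul, ha, hb, zero_mul, add_zero]

theorem annih_mem_adjoin {x : α} {s : Set α}
    (ψ : Module.Dual ℂ (FreeAlgebra ℂ α)) {P : FreeAlgebra ℂ α}
    (hP : P ∈ Algebra.adjoin ℂ (FreeAlgebra.ι ℂ '' s)) :
    annih x ψ P ∈ Algebra.adjoin ℂ (FreeAlgebra.ι ℂ '' s) := by
  induction hP using Algebra.adjoin_induction generalizing ψ with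
  | mem P h =>
    obtain ⟨l, hl, rfl⟩ := h
    rw [annih_ι]
    split_ifs
    · exact Subalgebra.smul_mem _ (one_mem _) _
    · exact zero_mem _
  | algebraMap r => rw [annih_algebraMap]; exact zero_mem _
  | add a b _ _ ha hb => rw [map_add]; exact add_mem (ha _) (hb _)
  | mul a b _ hb' ha hb => rw [annih_mul]; exact add_mem (mul_mem (ha _) hb') (hb _)

/-- A subspace of the free algebra that contains `1` and is stable under left multiplication by
letters is everything. -/
theorem freeAlgebra_left_induction {β : Type*} {K : Submodule ℂ (FreeAlgebra ℂ β)} (h1 : 1 ∈ K)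
    (hl : ∀ (l : β), ∀ W ∈ K, FreeAlgebra.ι ℂ l * W ∈ K) (W : FreeAlgebra ℂ β) : W ∈ K := by
  have key : ∀ U : FreeAlgebra ℂ β, ∀ W ∈ K, U * W ∈ K := by
    intro U
    induction U using FreeAlgebra.induction with
    | grade0 r =>
      intro W hW
      rw [Algebra.algebraMap_eq_smul_one, smul_mul_assoc, one_mul]
      exact K.smul_mem r hW
    | grade1 l => exact hl l
    | mul a b ha hb => intro W hW; rw [mul_assoc]; exact ha _ (hb _ hW)
    | add a b ha hb => intro W hW; rw [add_mul]; exact K.add_mem (ha _ hW) (hb _ hW)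
  simpa using key W 1 h1

end Annihilation

/-! ### The Schwinger-Dyson equation -/

section SchwingerDyson

variable {α : Type*} [DecidableEq α]

theorem annih_congr {x : α} {s : Set α} {ψ χ : Module.Dual ℂ (FreeAlgebra ℂ α)}
    (h : ∀ P ∈ Algebra.adjoin ℂ (FreeAlgebra.ι ℂ '' s), ψ P = χ P) {P : FreeAlgebra ℂ α}
    (hP : P ∈ Algebra.adjoin ℂ (FreeAlgebra.ι ℂ '' s)) : annih x ψ P = annih x χ P := by
  induction hP using Algebra.adjoin_induction generalizing ψ χ with
  | mem P hP => obtain ⟨l, hl, rfl⟩ := hP; rw [annih_ι, annih_ι, h 1 (one_mem _)]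
  | algebraMap r => rw [annih_algebraMap, annih_algebraMap]
  | add a b _ _ ha hb => rw [map_add, map_add, ha h, hb h]
  | mul a b ha' _ ha hb =>
    rw [annih_mul, annih_mul, ha h, hb (ψ := ψ ∘ₗ _) (χ := χ ∘ₗ _)]
    exact fun Q hQ => h _ (mul_mem ha' hQ)

/-- The functional `f` satisfies the Schwinger-Dyson equation at the letter `x` with variance `v`:
`f (x * W) = v * ∑ f (P) * f (Q)` over the factorizations `W = P * x * Q`. -/
def SchwingerDyson (f : Module.Dual ℂ (FreeAlgebra ℂ α)) (x : α) (v : ℂ) : Prop :=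
  ∀ W, f (FreeAlgebra.ι ℂ x * W) = v * f (annih x f W)

/-- The Schwinger-Dyson equation at `x` extends from the words without the letter `y` to all words
if it holds at `y` as well. By the equation at `y`, traces of words containing `y` are expressed
by traces of shorter words, and by coassociativity both sides at `x` reduce in the same way. -/
theorem SchwingerDyson.of_agree {f g : Module.Dual ℂ (FreeAlgebra ℂ α)}
    (hf : ∀ U V, f (U * V) = f (V * U)) {x y : α} (hxy : x ≠ y) {v w : ℂ}
    (hy : SchwingerDyson f y w) (hx : SchwingerDyson g x v)
    (hfg : ∀ P ∈ Algebra.adjoin ℂ (FreeAlgebra.ι ℂ '' {l | l ≠ y}), f P = g P) :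
    SchwingerDyson f x v := by
  set N := Algebra.adjoin ℂ (FreeAlgebra.ι ℂ '' {l : α | l ≠ y}) with hN
  have hι : ∀ l, l ≠ y → FreeAlgebra.ι ℂ l ∈ N := fun l hl =>
    Algebra.subset_adjoin ⟨l, hl, rfl⟩
  have hyN : y ∉ {l : α | l ≠ y} := fun h => h rfl
  have base : ∀ P ∈ N, f (FreeAlgebra.ι ℂ x * P) = v * f (annih x f P) := by
    intro P hP
    rw [hfg _ (mul_mem (hι x hxy) hP), hx P, annih_congr hfg hP, hfg _ (annih_mem_adjoin g hP)]
  have swap : ∀ Q ∈ N, ∀ U, f (Q * (FreeAlgebra.ι ℂ y * U)) = w * f (Q * annih y f U) := by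
    intro Q hQ U
    rw [hf, mul_assoc, hy, annih_mul, annih_eq_zero_of_mem_adjoin hyN _ hQ, add_zero, hf]
  have step : ∀ W, (∀ P ∈ N, f (FreeAlgebra.ι ℂ x * (P * annih y f W))
        = v * f (annih x f (P * annih y f W))) →
      ∀ P ∈ N, f (FreeAlgebra.ι ℂ x * (P * (FreeAlgebra.ι ℂ y * W)))
        = v * f (annih x f (P * (FreeAlgebra.ι ℂ y * W))) := by
    intro W hW P hP
    have e : (f ∘ₗ LinearMap.mulLeft ℂ P) ∘ₗ LinearMap.mulLeft ℂ (FreeAlgebra.ι ℂ y)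
        = w • ((f ∘ₗ LinearMap.mulLeft ℂ P) ∘ₗ annih y f) := by
      ext U; simpa using swap P hP U
    rw [← mul_assoc, swap _ (mul_mem (hι x hxy) hP), mul_assoc, hW P hP, annih_mul, annih_mul,
      annih_mul, annih_ι, if_neg hxy.symm, zero_mul, zero_add, e, annih_dual_smul, annih_annih,
      map_add, map_add, swap _ (annih_mem_adjoin f hP), map_smul, smul_eq_mul]
    ring
  let G : FreeAlgebra ℂ α →ₗ[ℂ] ℂ :=
    f ∘ₗ LinearMap.mulLeft ℂ (FreeAlgebra.ι ℂ x) - v • (f ∘ₗ annih x f)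
  have hG : ∀ W, G W = 0 ↔ f (FreeAlgebra.ι ℂ x * W) = v * f (annih x f W) := fun W => by
    simp [G, sub_eq_zero]
  let K : Submodule ℂ (FreeAlgebra ℂ α) :=
    { carrier := {W | (∀ P ∈ N, G (P * W) = 0) ∧ ∀ ψ, ∀ P ∈ N, G (P * annih y ψ W) = 0}
      add_mem' := by
        rintro a b ⟨h1, h2⟩ ⟨h3, h4⟩
        exact ⟨fun P hP => by rw [mul_add, map_add, h1 P hP, h3 P hP, add_zero],
          fun ψ P hP => by rw [map_add, mul_add, map_add, h2 ψ P hP, h4 ψ P hP, add_zero]⟩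
      zero_mem' := by simp
      smul_mem' := by
        rintro c a ⟨h1, h2⟩
        exact ⟨fun P hP => by rw [mul_smul_comm, map_smul, h1 P hP, smul_zero],
          fun ψ P hP => by rw [map_smul, mul_smul_comm, map_smul, h2 ψ P hP, smul_zero]⟩ }
  have hK : ∀ W, W ∈ K := by
    refine freeAlgebra_left_induction ?_ ?_
    · refine ⟨fun P hP => ?_, fun ψ P _ => by simp⟩
      rw [mul_one]
      exact (hG P).2 (base P hP)
    · rintro l W ⟨h1, h2⟩
      refine ⟨fun P hP => ?_, fun ψ P hP => ?_⟩
      · by_cases hl : l = y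
        · subst hl
          exact (hG _).2 (step W (fun P hP => (hG _).1 (h2 f P hP)) P hP)
        · rw [← mul_assoc]
          exact h1 _ (mul_mem hP (hι l hl))
      · rw [annih_mul, mul_add, map_add, h2 _ P hP, add_zero, annih_ι]
        split_ifs
        · rw [smul_mul_assoc, one_mul, mul_smul_comm, map_smul, h1 P hP, smul_zero]
        · simp
  intro W
  have := (hK W).1 1 (one_mem _)
  rw [one_mul] at this
  exact (hG W).1 this

end SchwingerDyson

/-! ### A variable that is free from a subalgebra -/

section Alternating

variable {A : Type*} [Ring A] [Algebra ℂ A]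

/-- The products `b₁ p₁ b₂ p₂ ⋯ pₖ₋₁ bₖ` of centred elements, alternately in `B` and `X`, that start
and end in `B`. -/
inductive AltWord (f : A →ₗ[ℂ] ℂ) (X B : Subalgebra ℂ A) : A → Prop
  | single {b : A} (hb : b ∈ B) (hb0 : f b = 0) : AltWord f X B b
  | cons {b p Y : A} (hb : b ∈ B) (hb0 : f b = 0) (hp : p ∈ X) (hp0 : f p = 0)
      (hY : AltWord f X B Y) : AltWord f X B (b * (p * Y))

variable {f : A →ₗ[ℂ] ℂ} {X B : Subalgebra ℂ A}

/-- An alternating product followed by an alternating word `w` that starts in `X` is the product of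
an alternating word in the sense of `Free`. -/
theorem AltWord.exists_list {Y : A} (hY : AltWord f X B Y) (w : List (Fin 2 × A))
    (hw : w.IsChain (fun p q => p.1 ≠ q.1)) (hmem : ∀ p ∈ w, p.2 ∈ (![X, B] : Fin 2 → _) p.1)
    (hzero : ∀ p ∈ w, f p.2 = 0) (hhead : ∀ p ∈ w.head?, p.1 = 0) :
    ∃ w' : List (Fin 2 × A), w'.IsChain (fun p q => p.1 ≠ q.1) ∧
      (∀ p ∈ w', p.2 ∈ (![X, B] : Fin 2 → _) p.1) ∧ (∀ p ∈ w', f p.2 = 0) ∧ w' ≠ [] ∧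
      (∀ p ∈ w'.head?, p.1 = 1) ∧ (w'.map Prod.snd).prod = Y * (w.map Prod.snd).prod := by
  induction hY with
  | @single b hb hb0 =>
    refine ⟨(1, b) :: w, List.isChain_cons.2 ⟨fun p hp => ?_, hw⟩, ?_, ?_, by simp, by simp,
      by simp⟩
    · simp [hhead p hp]
    · simpa [hb] using hmem
    · simpa [hb0] using hzero
  | @cons b p Y hb hb0 hp hp0 _ ih =>
    obtain ⟨w', h1, h2, h3, -, h5, h6⟩ := ih
    refine ⟨(1, b) :: (0, p) :: w', ?_, ?_, ?_, by simp, by simp, by simp [h6, mul_assoc]⟩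
    · refine List.isChain_cons.2 ⟨by simp, List.isChain_cons.2 ⟨fun q hq => ?_, h1⟩⟩
      simp [h5 q hq]
    · simpa [hb, hp] using h2
    · simpa [hb0, hp0] using h3

theorem AltWord.map_mul_eq_zero (hfree : Free f ![X, B]) (h1 : f 1 = 1) {Y : A}
    (hY : AltWord f X B Y) {r : A} (hr : r ∈ X) : f (Y * r) = 0 := by
  have hc : ∀ r ∈ X, f r = 0 → f (Y * r) = 0 := fun r hr hr0 => by
    obtain ⟨w, a1, a2, a3, a4, -, a6⟩ := hY.exists_list [(0, r)] (by simp) (by simpa using hr)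
      (by simpa using hr0) (by simp)
    have := hfree w a4 a1 a2 a3
    rw [a6] at this
    simpa using this
  have h0 : f Y = 0 := by
    obtain ⟨w, a1, a2, a3, a4, -, a6⟩ := hY.exists_list [] (by simp) (by simp) (by simp) (by simp)
    have := hfree w a4 a1 a2 a3
    rw [a6] at this
    simpa using this
  have := hc (r - f r • 1) (X.sub_mem hr (X.smul_mem (one_mem _) _)) (by simp [h1])
  simpa [mul_sub, h0] using this

theorem AltWord.map_mul_mul_eq_zero (hfree : Free f ![X, B]) (h1 : f 1 = 1)
    (htr : ∀ U V, f (U * V) = f (V * U)) {Y : A} (hY : AltWord f X B Y) {q r : A} (hq : q ∈ X)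
    (hr : r ∈ X) : f (q * (Y * r)) = 0 := by
  rw [htr, mul_assoc]
  exact hY.map_mul_eq_zero hfree h1 (mul_mem hr hq)

/-- The span of `X` and of all `q * Y * r` with `q, r ∈ X` and `Y` alternating is stable under left
multiplication by `B`. Only the two factors at the front have to be centred again. -/
theorem altSpan_mul_mem (h1 : f 1 = 1) {W : A} {b : A} (hb : b ∈ B)
    (hW : W ∈ Submodule.span ℂ {W : A | W ∈ X ∨ ∃ q ∈ X, ∃ Y, AltWord f X B Y ∧ ∃ r ∈ X,
      W = q * (Y * r)}) :
    b * W ∈ Submodule.span ℂ {W : A | W ∈ X ∨ ∃ q ∈ X, ∃ Y, AltWord f X B Y ∧ ∃ r ∈ X,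
      W = q * (Y * r)} := by
  set S := Submodule.span ℂ {W : A | W ∈ X ∨ ∃ q ∈ X, ∃ Y, AltWord f X B Y ∧ ∃ r ∈ X,
      W = q * (Y * r)} with hS
  have hXS : ∀ q ∈ X, q ∈ S := fun q hq => Submodule.subset_span (Or.inl hq)
  have hYS : ∀ q ∈ X, ∀ Y, AltWord f X B Y → ∀ r ∈ X, q * (Y * r) ∈ S := fun q hq Y hY r hr =>
    Submodule.subset_span (Or.inr ⟨q, hq, Y, hY, r, hr, rfl⟩)
  have hYS' : ∀ Y, AltWord f X B Y → ∀ r ∈ X, Y * r ∈ S := fun Y hY r hr => by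
    simpa using hYS 1 (one_mem _) Y hY r hr
  -- an element of `B` is the sum of a centred element and a scalar
  have split : ∀ C : Subalgebra ℂ A, ∀ c ∈ C, ∃ c₀ ∈ C, f c₀ = 0 ∧ c = c₀ + f c • 1 :=
    fun C c hc => ⟨c - f c • 1, C.sub_mem hc (C.smul_mem (one_mem _) _), by simp [h1], by simp⟩
  have hb_alt : ∀ b ∈ B, ∀ Y, AltWord f X B Y → ∀ r ∈ X, b * (Y * r) ∈ S := by
    intro b hb Y hY r hr
    cases hY with
    | single hb' hb0' =>
      obtain ⟨c, hc, hc0, e⟩ := split B (b * Y) (mul_mem hb hb')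
      rw [← mul_assoc, e, add_mul, smul_mul_assoc, one_mul]
      exact S.add_mem (hYS' c (.single hc hc0) r hr) (S.smul_mem _ (hXS r hr))
    | @cons b' p Y' hb' hb0' hp hp0 hY' =>
      obtain ⟨c, hc, hc0, e⟩ := split B (b * b') (mul_mem hb hb')
      have : b * (b' * (p * Y') * r) = c * (p * Y') * r + f (b * b') • (p * (Y' * r)) := by
        calc b * (b' * (p * Y') * r) = (b * b') * (p * (Y' * r)) := by simp only [mul_assoc]
          _ = _ := by
            rw [e]
            simp only [add_mul, smul_mul_assoc, one_mul, mul_assoc, map_add, map_smul, hc0, h1,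
              zero_add, smul_eq_mul, mul_one]
      rw [this]
      exact S.add_mem (hYS' _ (.cons hc hc0 hp hp0 hY') r hr) (S.smul_mem _ (hYS p hp Y' hY' r hr))
  induction hW using Submodule.span_induction with
  | mem W hW =>
    rcases hW with hW | ⟨q, hq, Y, hY, r, hr, rfl⟩
    · obtain ⟨c, hc, hc0, e⟩ := split B b hb
      rw [e, add_mul, smul_mul_assoc, one_mul]
      exact S.add_mem (hYS' c (.single hc hc0) W hW) (S.smul_mem _ (hXS W hW))
    · obtain ⟨c, hc, hc0, e⟩ := split B b hb
      obtain ⟨p, hp, hp0, e'⟩ := split X q hq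
      have : b * (q * (Y * r)) = (c * (p * Y) * r + f q • (c * (Y * r))) + f b • (q * (Y * r)) := by
        conv_lhs => rw [e, add_mul, smul_mul_assoc, one_mul]
        congr 1
        conv_lhs => rw [e']
        simp only [add_mul, smul_mul_assoc, one_mul, mul_assoc, mul_add, mul_smul_comm]
      rw [this]
      exact S.add_mem (S.add_mem (hYS' _ (.cons hc hc0 hp hp0 hY) r hr)
        (S.smul_mem _ (hb_alt c hc Y hY r hr))) (S.smul_mem _ (hYS q hq Y hY r hr))
  | zero => simp
  | add U V _ _ hU hV => rw [mul_add]; exact S.add_mem hU hV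
  | smul c U _ hU => rw [mul_smul_comm]; exact S.smul_mem _ hU

end Alternating

section OfFree

variable {α : Type*} [DecidableEq α]

/-- If the letter `x` is free from the other letters, the Schwinger-Dyson equation at `x` follows
from the one for powers of `x`. The algebra is spanned by polynomials in `x` and the products
`q * Y * r` with `q, r` polynomials in `x` and `Y` alternating. On the latter both sides vanish,
because in every term one of the traces is that of such a product. -/
theorem SchwingerDyson.of_free {f : Module.Dual ℂ (FreeAlgebra ℂ α)} (h1 : f 1 = 1)
    (htr : ∀ U V, f (U * V) = f (V * U)) {x : α} {v : ℂ}
    (hfree : Free f ![Algebra.adjoin ℂ {FreeAlgebra.ι ℂ x},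
      Algebra.adjoin ℂ (FreeAlgebra.ι ℂ '' {l | l ≠ x})])
    (hx : ∀ n : ℕ, f (FreeAlgebra.ι ℂ x * FreeAlgebra.ι ℂ x ^ n)
      = v * f (annih x f (FreeAlgebra.ι ℂ x ^ n))) :
    SchwingerDyson f x v := by
  set X := Algebra.adjoin ℂ {FreeAlgebra.ι ℂ x} with hX
  set B := Algebra.adjoin ℂ (FreeAlgebra.ι ℂ '' {l : α | l ≠ x}) with hB
  have hX' : X = Algebra.adjoin ℂ (FreeAlgebra.ι ℂ '' {x}) := by rw [hX, Set.image_singleton]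
  have hxX : FreeAlgebra.ι ℂ x ∈ X := Algebra.subset_adjoin rfl
  have annih_X : ∀ ψ, ∀ p ∈ X, annih x ψ p ∈ X := fun ψ p hp => by
    rw [hX'] at hp ⊢; exact annih_mem_adjoin ψ hp
  have annih_B : ∀ ψ, ∀ b ∈ B, annih x ψ b = 0 := fun ψ b hb =>
    annih_eq_zero_of_mem_adjoin (s := {l | l ≠ x}) (fun h => h rfl) ψ hb
  have van : ∀ {Y}, AltWord f X B Y → ∀ q ∈ X, ∀ r ∈ X, f (q * (Y * r)) = 0 :=
    fun hY q hq r hr => hY.map_mul_mul_eq_zero hfree h1 htr hq hr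
  have right : ∀ {Y}, AltWord f X B Y → ∀ u, (∀ p ∈ X, f (u * (Y * p)) = 0) → ∀ r ∈ X,
      f (annih x (f ∘ₗ LinearMap.mulLeft ℂ u) (Y * r)) = 0 := by
    intro Y hY
    induction hY with
    | @single b hb hb0 =>
      intro u hu r hr
      rw [annih_mul, annih_B _ b hb, zero_mul, zero_add]
      rw [hX'] at hr
      rw [annih_congr (χ := 0) _ hr]
      · simpa using congrArg f (annih_dual_smul x 0 0 r)
      · intro P hP
        rw [← hX'] at hP
        simpa using hu P hP
    | @cons b p Y hb hb0 hp hp0 hY ih =>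
      intro u hu r hr
      rw [mul_assoc, annih_mul, annih_B _ b hb, zero_mul, zero_add, mul_assoc, annih_mul, map_add,
        van hY _ (annih_X _ p hp) r hr, zero_add]
      have := ih (u * (b * p)) (fun p' hp' => by simpa [mul_assoc] using hu p' hp') r hr
      convert this using 3
      simp [LinearMap.comp_assoc]
  let G : FreeAlgebra ℂ α →ₗ[ℂ] ℂ :=
    f ∘ₗ LinearMap.mulLeft ℂ (FreeAlgebra.ι ℂ x) - v • (f ∘ₗ annih x f)
  have hG : ∀ W, G W = 0 ↔ f (FreeAlgebra.ι ℂ x * W) = v * f (annih x f W) := fun W => by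
    simp [G, sub_eq_zero]
  intro W
  rw [← hG]
  have hW : W ∈ Submodule.span ℂ {W | W ∈ X ∨ ∃ q ∈ X, ∃ Y, AltWord f X B Y ∧ ∃ r ∈ X,
      W = q * (Y * r)} := by
    refine freeAlgebra_left_induction (Submodule.subset_span (Or.inl (one_mem _))) ?_ W
    intro l W hW
    by_cases hl : l = x
    · subst hl
      induction hW using Submodule.span_induction with
      | mem W hW =>
        refine Submodule.subset_span ?_
        rcases hW with hW | ⟨q, hq, Y, hY, r, hr, rfl⟩
        · exact Or.inl (mul_mem hxX hW)
        · exact Or.inr ⟨_, mul_mem hxX hq, Y, hY, r, hr, by rw [mul_assoc]⟩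
      | zero => simp
      | add U V _ _ hU hV => rw [mul_add]; exact Submodule.add_mem _ hU hV
      | smul c U _ hU => rw [mul_smul_comm]; exact Submodule.smul_mem _ _ hU
    · exact altSpan_mul_mem h1 (Algebra.subset_adjoin ⟨l, hl, rfl⟩) hW
  have hker : Submodule.span ℂ {W | W ∈ X ∨ ∃ q ∈ X, ∃ Y, AltWord f X B Y ∧ ∃ r ∈ X,
      W = q * (Y * r)} ≤ LinearMap.ker G := by
    rw [Submodule.span_le]
    rintro W (hW | ⟨q, hq, Y, hY, r, hr, rfl⟩)
    · have : X.toSubmodule ≤ LinearMap.ker G := by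
        rw [hX, Algebra.adjoin_singleton_eq_range_aeval]
        rintro _ ⟨p, rfl⟩
        have : (Polynomial.aeval (FreeAlgebra.ι ℂ x)) p
            = p.sum fun n c => c • FreeAlgebra.ι ℂ x ^ n := by
          rw [Polynomial.aeval_eq_sum_range, Polynomial.sum_over_range]
          simp
        simp only [AlgHom.toRingHom_eq_coe, RingHom.coe_coe, this, Polynomial.sum]
        exact Submodule.sum_mem _ fun n _ => Submodule.smul_mem _ _ ((hG _).2 (hx n))
      exact this hW
    · show G _ = 0
      rw [hG, ← mul_assoc, van hY _ (mul_mem hxX hq) r hr, annih_mul, map_add,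
        van hY _ (annih_X _ q hq) r hr, right hY q (fun p hp => van hY q hq p hp) r hr]
      simp
  exact hker hW

end OfFree

/-! ### Moments of the semicircle distribution -/

section Semicircle

theorem succ_succ_mul_catalan_succ (k : ℕ) :
    (k + 2) * catalan (k + 1) = 2 * (2 * k + 1) * catalan k := by
  have h1 := succ_mul_catalan_eq_centralBinom k
  have h2 := succ_mul_catalan_eq_centralBinom (k + 1)
  have h3 := Nat.succ_mul_centralBinom_succ k
  rw [← h1, ← h2] at h3
  have h4 : (k + 1) * ((k + 2) * catalan (k + 1)) = (k + 1) * (2 * (2 * k + 1) * catalan k) := by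
    rw [show k + 2 = k + 1 + 1 from rfl, h3]; ring
  exact Nat.eq_of_mul_eq_mul_left k.succ_pos h4

/-- The sequence with the terms `v ^ k * catalan k` at even places and zeros at odd places satisfies
a quadratic recursion, as the Catalan numbers do. -/
theorem sum_antidiagonal_of_even_support (m : ℕ → ℝ) (v : ℝ)
    (h0 : ∀ k, m (2 * k) = v ^ k * catalan k)
    (h1 : ∀ k, m (2 * k + 1) = 0) (n : ℕ) :
    m (n + 2) = v * ∑ ij ∈ Finset.HasAntidiagonal.antidiagonal n, m ij.1 * m ij.2 := by
  obtain ⟨k, rfl | rfl⟩ := Nat.even_or_odd' n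
  · have : ∑ ij ∈ Finset.HasAntidiagonal.antidiagonal (2 * k), m ij.1 * m ij.2
        = ∑ ij ∈ Finset.HasAntidiagonal.antidiagonal k, m (2 * ij.1) * m (2 * ij.2) := by
      symm
      refine Finset.sum_of_injOn (fun ij => (2 * ij.1, 2 * ij.2)) ?_ ?_ ?_ ?_
      · rintro ⟨a, b⟩ _ ⟨c, d⟩ _ h
        simp only [Prod.mk.injEq] at h ⊢
        omega
      · rintro ⟨a, b⟩ h
        simp only [Finset.mem_coe, Finset.HasAntidiagonal.mem_antidiagonal] at h ⊢
        omega
      · rintro ⟨a, b⟩ h hn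
        simp only [Finset.HasAntidiagonal.mem_antidiagonal] at h
        obtain ⟨c, rfl | rfl⟩ := Nat.even_or_odd' a
        · exact absurd ⟨(c, k - c), by simp; omega, by simp; omega⟩ hn
        · simp [h1]
      · simp
    rw [this, show 2 * k + 2 = 2 * (k + 1) by ring, h0, catalan_succ']
    push_cast
    rw [Finset.mul_sum, Finset.mul_sum]
    refine Finset.sum_congr rfl fun ij hij => ?_
    rw [h0, h0, ← Finset.HasAntidiagonal.mem_antidiagonal.1 hij]
    ring
  · rw [show 2 * k + 1 + 2 = 2 * (k + 1) + 1 by ring, h1, Finset.sum_eq_zero, mul_zero]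
    rintro ⟨a, b⟩ h
    simp only [Finset.HasAntidiagonal.mem_antidiagonal] at h ⊢
    obtain ⟨c, rfl | rfl⟩ := Nat.even_or_odd' a
    · rw [show b = 2 * (k - c) + 1 by omega, h1, mul_zero]
    · rw [h1, zero_mul]

/-- Integration of the derivative of `x ^ (n + 1) * (R ^ 2 - x ^ 2) ^ (3 / 2)`, which vanishes at
`± R`. -/
theorem integral_pow_mul_sqrt (R : ℝ) (hR : 0 < R) (n : ℕ) :
    (n + 4) * ∫ x in (-R)..R, x ^ (n + 2) * √(R ^ 2 - x ^ 2)
      = R ^ 2 * (n + 1) * ∫ x in (-R)..R, x ^ n * √(R ^ 2 - x ^ 2) := by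
  have hd : ∀ x ∈ Set.Ioo (-R) R,
      HasDerivAt (fun x : ℝ => x ^ (n + 1) * ((R ^ 2 - x ^ 2) * √(R ^ 2 - x ^ 2)))
        (R ^ 2 * (n + 1) * (x ^ n * √(R ^ 2 - x ^ 2))
          - (n + 4) * (x ^ (n + 2) * √(R ^ 2 - x ^ 2))) x := by
    intro x hx
    have hpos : 0 < R ^ 2 - x ^ 2 := by nlinarith [hx.1, hx.2]
    have h1 : HasDerivAt (fun x : ℝ => R ^ 2 - x ^ 2) (-(2 * x)) x := by
      simpa using (hasDerivAt_pow 2 x).const_sub (R ^ 2)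
    refine ((hasDerivAt_pow (n + 1) x).mul (h1.mul (h1.sqrt hpos.ne'))).congr_deriv ?_
    change (n + 1 : ℕ) * x ^ n * ((R ^ 2 - x ^ 2) * √(R ^ 2 - x ^ 2)) + _ = _
    have hs : √(R ^ 2 - x ^ 2) ≠ 0 := (Real.sqrt_pos.2 hpos).ne'
    have hss : √(R ^ 2 - x ^ 2) ^ 2 = R ^ 2 - x ^ 2 := Real.sq_sqrt hpos.le
    field_simp
    rw [hss]
    push_cast
    ring
  have hc : ∀ k : ℕ, Continuous fun x : ℝ => x ^ k * √(R ^ 2 - x ^ 2) := fun k => by fun_prop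
  have key := intervalIntegral.integral_eq_sub_of_hasDerivAt_of_le (a := -R) (b := R) (by linarith)
    (f := fun x : ℝ => x ^ (n + 1) * ((R ^ 2 - x ^ 2) * √(R ^ 2 - x ^ 2)))
    (by fun_prop) hd
    ((((hc n).const_mul _).sub ((hc (n + 2)).const_mul _)).intervalIntegrable _ _)
  rw [intervalIntegral.integral_sub (((hc n).const_mul _).intervalIntegrable _ _)
    (((hc (n + 2)).const_mul _).intervalIntegrable _ _), intervalIntegral.integral_const_mul,
    intervalIntegral.integral_const_mul] at key
  simp at key
  linarith

theorem integral_sqrt_sq_sub_sq (R : ℝ) (hR : 0 < R) :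
    ∫ x in (-R)..R, √(R ^ 2 - x ^ 2) = R ^ 2 * Real.pi / 2 := by
  have := intervalIntegral.integral_comp_mul_left (a := -1) (b := 1)
    (fun x => √(R ^ 2 - x ^ 2)) hR.ne'
  simp only [mul_neg, mul_one, smul_eq_mul] at this
  have e : ∀ x : ℝ, √(R ^ 2 - (R * x) ^ 2) = R * √(1 - x ^ 2) := fun x => by
    rw [show R ^ 2 - (R * x) ^ 2 = R ^ 2 * (1 - x ^ 2) by ring, Real.sqrt_mul (sq_nonneg R),
      Real.sqrt_sq hR.le]
  simp only [e] at this
  rw [intervalIntegral.integral_const_mul, integral_sqrt_one_sub_sq] at this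
  field_simp at this
  linarith

theorem integral_pow_semicircle (v : ℝ≥0) (hv : v ≠ 0) (n : ℕ) :
    ∫ y, y ^ n ∂semicircle v
      = (2 * Real.pi * v)⁻¹
        * ∫ x in (-(2 * √(v : ℝ)))..(2 * √(v : ℝ)), x ^ n * √((2 * √(v : ℝ)) ^ 2 - x ^ 2) := by
  have hv' : (0 : ℝ) < v := by positivity
  have hsq : (2 * √(v : ℝ)) ^ 2 = 4 * v := by rw [mul_pow, Real.sq_sqrt hv'.le]; norm_num
  have hR : 0 < 2 * √(v : ℝ) := by positivity
  rw [semicircle, if_neg hv, integral_withDensity_eq_integral_toReal_smul (by fun_prop) (by simp),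
    hsq, intervalIntegral.integral_of_le (by linarith), ← integral_const_mul,
    ← setIntegral_eq_integral_of_forall_compl_eq_zero
      (s := Set.Ioc (-(2 * √(v : ℝ))) (2 * √(v : ℝ)))]
  · refine setIntegral_congr_fun measurableSet_Ioc fun x _ => ?_
    simp only [smul_eq_mul]
    rw [ENNReal.toReal_ofReal (by positivity)]
    ring
  · intro x hx
    have : 4 * (v : ℝ) - x ^ 2 ≤ 0 := by
      rw [← hsq, sub_nonpos]
      refine sq_le_sq' ?_ ?_ |>.trans_eq (sq_abs x) <;>
      · simp only [Set.mem_Ioc, not_and_or, not_lt, not_le] at hx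
        rcases hx with hx | hx
        · have := neg_le_abs x; have := abs_nonneg x; linarith
        · have := le_abs_self x; have := abs_nonneg x; linarith
    simp [Real.sqrt_eq_zero_of_nonpos this]

/-- The even moments of the semicircle distribution are Catalan numbers times powers of the
variance, the odd ones vanish. -/
theorem moments_semicircle (v : ℝ≥0) (hv : v ≠ 0) (k : ℕ) :
    ∫ y, y ^ (2 * k) ∂semicircle v = (v : ℝ) ^ k * catalan k ∧
      ∫ y, y ^ (2 * k + 1) ∂semicircle v = 0 := by
  have hv' : (0 : ℝ) < v := by positivity
  have hsq : (2 * √(v : ℝ)) ^ 2 = 4 * v := by rw [mul_pow, Real.sq_sqrt hv'.le]; norm_num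
  have hR : 0 < 2 * √(v : ℝ) := by positivity
  have hrec : ∀ n : ℕ, (n + 4) * ∫ y, y ^ (n + 2) ∂semicircle v
      = 4 * v * (n + 1) * ∫ y, y ^ n ∂semicircle v := fun n => by
    have := integral_pow_mul_sqrt _ hR n
    rw [integral_pow_semicircle v hv, integral_pow_semicircle v hv, mul_left_comm, this, hsq]
    ring
  induction k with
  | zero =>
    constructor
    · rw [integral_pow_semicircle v hv]
      simp only [mul_zero, pow_zero, one_mul, catalan_zero, Nat.cast_one, mul_one]
      rw [integral_sqrt_sq_sub_sq _ hR, hsq]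
      field_simp
      norm_num
    · rw [integral_pow_semicircle v hv]
      have : ∫ x in (-(2 * √(v : ℝ)))..(2 * √(v : ℝ)),
          x ^ (2 * 0 + 1) * √((2 * √(v : ℝ)) ^ 2 - x ^ 2) = 0 := by
        have h := intervalIntegral.integral_comp_neg (a := -(2 * √(v : ℝ))) (b := 2 * √(v : ℝ))
          (fun x => x ^ (2 * 0 + 1) * √((2 * √(v : ℝ)) ^ 2 - x ^ 2))
        simp only [mul_zero, zero_add, pow_one, neg_neg, neg_sq, neg_mul,
          intervalIntegral.integral_neg] at h ⊢
        linarith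
      rw [this, mul_zero]
  | succ k ih =>
    constructor
    · have h := hrec (2 * k)
      have hc : ((k : ℝ) + 2) * catalan (k + 1) = 2 * (2 * k + 1) * catalan k := by
        exact_mod_cast succ_succ_mul_catalan_succ k
      rw [ih.1] at h
      push_cast at h
      have hk : (2 * (k : ℝ) + 4) ≠ 0 := by positivity
      apply mul_left_cancel₀ hk
      rw [show 2 * (k + 1) = 2 * k + 2 by ring, h]
      linear_combination (-2 * (v : ℝ) ^ (k + 1)) * hc
    · have h := hrec (2 * k + 1)
      rw [ih.2, mul_zero] at h
      have hk : (((2 * k + 1 : ℕ) : ℝ) + 4) ≠ 0 := by positivity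
      exact (mul_eq_zero.1 h).resolve_left hk

theorem semicircle_moment_recursion (v : ℝ≥0) (hv : v ≠ 0) (n : ℕ) :
    ∫ y, y ^ (n + 2) ∂semicircle v = v * ∑ ij ∈ Finset.HasAntidiagonal.antidiagonal n,
      (∫ y, y ^ ij.1 ∂semicircle v) * ∫ y, y ^ ij.2 ∂semicircle v :=
  sum_antidiagonal_of_even_support (fun n => ∫ y, y ^ n ∂semicircle v) v
    (fun k => (moments_semicircle v hv k).1) (fun k => (moments_semicircle v hv k).2) n

end Semicircle

section SemicircularLetter

variable {α : Type*} [DecidableEq α]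

theorem annih_pow (x : α) (ψ : Module.Dual ℂ (FreeAlgebra ℂ α)) (n : ℕ) :
    annih x ψ (FreeAlgebra.ι ℂ x ^ (n + 1)) = ∑ ij ∈ Finset.HasAntidiagonal.antidiagonal n,
      ψ (FreeAlgebra.ι ℂ x ^ ij.1) • FreeAlgebra.ι ℂ x ^ ij.2 := by
  induction n generalizing ψ with
  | zero => simp [annih_ι]
  | succ n ih =>
    rw [pow_succ', annih_mul, annih_ι, if_pos rfl, ih, Finset.Nat.sum_antidiagonal_succ]
    simp [pow_succ']

/-- The Schwinger-Dyson equation on the powers of a semicircular letter. -/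
theorem semicircle_annih_pow {f : Module.Dual ℂ (FreeAlgebra ℂ α)} {x : α} {v : ℝ≥0} (hv : v ≠ 0)
    (hf : ∀ n : ℕ, f (FreeAlgebra.ι ℂ x ^ n) = ((∫ y : ℝ, y ^ n ∂semicircle v : ℝ) : ℂ)) (n : ℕ) :
    f (FreeAlgebra.ι ℂ x * FreeAlgebra.ι ℂ x ^ n)
      = (v : ℂ) * f (annih x f (FreeAlgebra.ι ℂ x ^ n)) := by
  rcases n with _ | n
  · have := hf 1
    rw [show (1 : ℕ) = 2 * 0 + 1 by rfl, (moments_semicircle v hv 0).2] at this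
    simpa using this
  · rw [← pow_succ', hf, annih_pow, semicircle_moment_recursion v hv]
    simp [hf]

end SemicircularLetter

/-! ### Sequentially free semicircular families -/

section Joint

variable {A : Type*} [Ring A] [Algebra ℂ A]

theorem Free.comap {R : Type*} [Ring R] [Algebra ℂ R] {φ : A →ₗ[ℂ] ℂ} {ι : Type*}
    {B : ι → Subalgebra ℂ A} (h : Free φ B) (g : R →ₐ[ℂ] A) {C : ι → Subalgebra ℂ R}
    (hC : ∀ i, C i ≤ (B i).comap g) : Free (φ ∘ₗ g.toLinearMap) C := by
  intro w hw hchain hmem hzero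
  have := h (w.map fun p => (p.1, g p.2)) (by simpa using hw)
    (by rw [List.isChain_map]; exact hchain)
    (by
      simp only [List.mem_map]
      rintro _ ⟨p, hp, rfl⟩
      exact hC _ (hmem p hp))
    (by
      simp only [List.mem_map]
      rintro _ ⟨p, hp, rfl⟩
      exact hzero p hp)
  rw [List.map_map] at this
  simp only [LinearMap.comp_apply, AlgHom.toLinearMap_apply, map_list_prod, List.map_map]
  exact this

variable {α : Type*} [DecidableEq α]

theorem lift_eq_of_mem_adjoin {β : Type*} {e e' : β → A} {s : Set β} (h : ∀ l ∈ s, e l = e' l)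
    {P : FreeAlgebra ℂ β} (hP : P ∈ Algebra.adjoin ℂ (FreeAlgebra.ι ℂ '' s)) :
    FreeAlgebra.lift ℂ e P = FreeAlgebra.lift ℂ e' P := by
  induction hP using Algebra.adjoin_induction with
  | mem P hP => obtain ⟨l, hl, rfl⟩ := hP; simp [h l hl]
  | algebraMap r => simp
  | add a b _ _ ha hb => simp [ha, hb]
  | mul a b _ _ ha hb => simp [ha, hb]

theorem SchwingerDyson.of_freeFrom {φ : A →ₗ[ℂ] ℂ} (h1 : φ 1 = 1)
    (htr : ∀ a b, φ (a * b) = φ (b * a)) (e : α → A) (x : α) (B : Subalgebra ℂ A)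
    (heB : ∀ l, l ≠ x → e l ∈ B) (hfree : FreeFrom φ (e x) B) {v : ℝ≥0} (hv : v ≠ 0)
    (hdist : HasDistribution φ (e x) (semicircle v)) :
    SchwingerDyson (φ ∘ₗ (FreeAlgebra.lift ℂ e).toLinearMap) x v := by
  refine SchwingerDyson.of_free (by simp [h1]) (fun U V => by simp [htr]) ?_
    (semicircle_annih_pow hv fun n => by simpa using hdist n)
  refine Free.comap hfree _ fun i => ?_
  fin_cases i
  · refine Algebra.adjoin_le ?_
    rintro _ rfl
    simp
  · refine Algebra.adjoin_le ?_
    rintro _ ⟨l, hl, rfl⟩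
    simpa [Subalgebra.mem_comap] using heB l hl

theorem schwingerDyson_of_eval_eq_zero (φ : A →ₗ[ℂ] ℂ) (e : α → A) (x : α) (hx : e x = 0) :
    SchwingerDyson (φ ∘ₗ (FreeAlgebra.lift ℂ e).toLinearMap) x 0 := fun W => by simp [hx]

/-- If every `X i` is zero or semicircular and free from an algebra `B i` that contains the `a k`
and the `X j` with `j < i`, then the Schwinger-Dyson equation holds at every `X i` on all words in
the `a k` and the `X j`, including those with `j > i`. -/
theorem schwingerDyson_of_sequentially_free {κ : Type*} [DecidableEq κ] {n : ℕ} {φ : A →ₗ[ℂ] ℂ}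
    (h1 : φ 1 = 1) (htr : ∀ a b, φ (a * b) = φ (b * a)) (a : κ → A) (X : Fin n → A)
    (v : Fin n → ℝ≥0) (B : Fin n → Subalgebra ℂ A) (haB : ∀ k i, a k ∈ B i)
    (hXB : ∀ i j, j < i → X j ∈ B i)
    (hX : ∀ i, X i = 0 ∧ v i = 0 ∨ v i ≠ 0 ∧ FreeFrom φ (X i) (B i) ∧
      HasDistribution φ (X i) (semicircle (v i))) (i : Fin n) :
    SchwingerDyson (φ ∘ₗ (FreeAlgebra.lift ℂ (Sum.elim a X)).toLinearMap) (Sum.inr i) (v i) := by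
  -- Induct on `m` for the family in which the variables from `m` on are replaced by zero, so that
  -- all families live on the same free algebra.
  have key : ∀ m : ℕ, m ≤ n → ∀ i : Fin n, SchwingerDyson
      (φ ∘ₗ (FreeAlgebra.lift ℂ
        (Sum.elim a fun j : Fin n => if (j : ℕ) < m then X j else 0)).toLinearMap)
      (Sum.inr i) ((if (i : ℕ) < m then v i else 0 : ℝ≥0) : ℂ) := by
    intro m
    induction m with
    | zero =>
      intro _ i
      simpa using schwingerDyson_of_eval_eq_zero φ
        (Sum.elim a fun j : Fin n => if (j : ℕ) < 0 then X j else 0) (Sum.inr i) (by simp)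
    | succ m ih =>
      intro hm i
      set e : κ ⊕ Fin n → A := Sum.elim a fun j : Fin n => if (j : ℕ) < m + 1 then X j else 0
        with he
      let y : Fin n := ⟨m, hm⟩
      have hey : e (Sum.inr y) = X y := by simp [he, y]
      have hy : SchwingerDyson (φ ∘ₗ (FreeAlgebra.lift ℂ e).toLinearMap) (Sum.inr y) (v y) := by
        rcases hX y with ⟨h0, hv0⟩ | ⟨hv, hf, hd⟩
        · rw [hv0]
          simpa using schwingerDyson_of_eval_eq_zero φ e (Sum.inr y) (hey.trans h0)
        · refine SchwingerDyson.of_freeFrom h1 htr e _ (B y) ?_ (by rwa [hey]) hv (by rwa [hey])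
          rintro (k | j) hl
          · exact haB k y
          · simp only [he, Sum.elim_inr]
            split_ifs with hj
            · refine hXB y j (lt_of_le_of_ne (Nat.lt_succ_iff.1 hj) fun h => hl ?_)
              rw [h]
            · exact zero_mem _
      by_cases hi : i = y
      · subst hi
        simpa [y] using hy
      · have him : (i : ℕ) ≠ m := fun h => hi (Fin.ext h)
        have hif : (if (i : ℕ) < m + 1 then v i else 0) = if (i : ℕ) < m then v i else 0 := by
          have : (i : ℕ) < m + 1 ↔ (i : ℕ) < m := by omega
          simp only [this]
        rw [hif]
        refine SchwingerDyson.of_agree (fun U V => by simp [htr]) (by simpa using hi) hy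
          (ih (by omega) i) fun P hP => ?_
        refine congrArg φ (lift_eq_of_mem_adjoin ?_ hP)
        rintro (k | j) hl
        · rfl
        · have hjm : (j : ℕ) ≠ m := fun h => hl (congrArg Sum.inr (Fin.ext h))
          have : (j : ℕ) < m + 1 ↔ (j : ℕ) < m := by omega
          simp only [he, Sum.elim_inr, this]
  simpa using key n le_rfl i

end Joint

/-! ### Adjoints of the annihilation operators -/

section Adjoint

variable {A : Type*} [Ring A] [StarRing A] [Algebra ℂ A] [StarModule ℂ A]
variable {α : Type*} [DecidableEq α]

/-- The conjugate functional `a ↦ conj (ψ (a⋆))`. -/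
noncomputable def conjDual (ψ : A →ₗ[ℂ] ℂ) : A →ₗ[ℂ] ℂ where
  toFun a := star (ψ (star a))
  map_add' a b := by simp
  map_smul' c a := by simp

@[simp]
theorem conjDual_apply (ψ : A →ₗ[ℂ] ℂ) (a : A) : conjDual ψ a = star (ψ (star a)) := rfl

/-- Every `U` in the free algebra has a formal adjoint: the words reversed, the letters replaced by
their `σ`-partners, the coefficients conjugated. It exchanges the two functionals to the left and
to the right of the letter that `annih` removes. -/
theorem exists_formal_star (e : α → A) (σ : α → α) (hσ : ∀ l, e (σ l) = star (e l)) (x : α)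
    (hx : ∀ l, σ l = x ↔ l = x) (U : FreeAlgebra ℂ α) :
    ∃ U' : FreeAlgebra ℂ α, FreeAlgebra.lift ℂ e U' = star (FreeAlgebra.lift ℂ e U) ∧
      ∀ χ ψ : A →ₗ[ℂ] ℂ,
        χ (FreeAlgebra.lift ℂ e (annih x (ψ ∘ₗ (FreeAlgebra.lift ℂ e).toLinearMap) U'))
          = star (conjDual ψ (FreeAlgebra.lift ℂ e
              (annih x (conjDual χ ∘ₗ (FreeAlgebra.lift ℂ e).toLinearMap) U))) := by
  induction U using FreeAlgebra.induction with
  | grade0 r =>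
    refine ⟨algebraMap ℂ _ (star r), ?_, fun χ ψ => by simp [annih_algebraMap]⟩
    simp only [AlgHom.commutes]
    exact algebraMap_star_comm r
  | grade1 l =>
    refine ⟨FreeAlgebra.ι ℂ (σ l), by simp [hσ], fun χ ψ => ?_⟩
    rw [annih_ι, annih_ι]
    simp only [hx]
    split_ifs
    · simp [mul_comm]
    · simp
  | mul U₁ U₂ h₁ h₂ =>
    obtain ⟨V₁, e₁, h₁⟩ := h₁
    obtain ⟨V₂, e₂, h₂⟩ := h₂
    refine ⟨V₂ * V₁, by simp [e₁, e₂], fun χ ψ => ?_⟩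
    have a₁ := h₁ χ (ψ ∘ₗ LinearMap.mulLeft ℂ (star (FreeAlgebra.lift ℂ e U₂)))
    have a₂ := h₂ (χ ∘ₗ LinearMap.mulRight ℂ (star (FreeAlgebra.lift ℂ e U₁))) ψ
    have b₁ : (ψ ∘ₗ (FreeAlgebra.lift ℂ e).toLinearMap) ∘ₗ LinearMap.mulLeft ℂ V₂
        = (ψ ∘ₗ LinearMap.mulLeft ℂ (star (FreeAlgebra.lift ℂ e U₂)))
          ∘ₗ (FreeAlgebra.lift ℂ e).toLinearMap := by
      ext W; simp [e₂]
    have b₂ : (conjDual χ ∘ₗ (FreeAlgebra.lift ℂ e).toLinearMap) ∘ₗ LinearMap.mulLeft ℂ U₁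
        = conjDual (χ ∘ₗ LinearMap.mulRight ℂ (star (FreeAlgebra.lift ℂ e U₁)))
          ∘ₗ (FreeAlgebra.lift ℂ e).toLinearMap := by
      ext W; simp
    rw [annih_mul, annih_mul, b₁, b₂, map_add, map_add, a₁, map_mul, e₁]
    refine (congrArg₂ (· + ·) a₂ rfl).trans ?_
    simp only [map_add, map_mul, conjDual_apply, star_add, star_mul, star_star,
      LinearMap.comp_apply, LinearMap.mulLeft_apply]
    exact add_comm _ _
  | add U₁ U₂ h₁ h₂ =>
    obtain ⟨V₁, e₁, h₁⟩ := h₁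
    obtain ⟨V₂, e₂, h₂⟩ := h₂
    refine ⟨V₁ + V₂, by simp [e₁, e₂], fun χ ψ => ?_⟩
    rw [map_add, map_add, map_add, h₁, h₂]
    simp

/-- Multiplication by the self-adjoint letter `x` is the sum of `v • annih x φ` and its adjoint for
the inner product `φ (star U * V)`. -/
theorem SchwingerDyson.adjoint {φ : A →ₗ[ℂ] ℂ} (htr : ∀ a b, φ (a * b) = φ (b * a))
    (hstar : ∀ a, φ (star a) = star (φ a)) (e : α → A) (σ : α → α)
    (hσ : ∀ l, e (σ l) = star (e l)) (x : α) (hx : ∀ l, σ l = x ↔ l = x) {v : ℝ≥0}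
    (h : SchwingerDyson (φ ∘ₗ (FreeAlgebra.lift ℂ e).toLinearMap) x v) (U V : FreeAlgebra ℂ α) :
    φ (star (FreeAlgebra.lift ℂ e U) * (e x * FreeAlgebra.lift ℂ e V))
      = v * φ (star (FreeAlgebra.lift ℂ e
            (annih x (φ ∘ₗ (FreeAlgebra.lift ℂ e).toLinearMap) U)) * FreeAlgebra.lift ℂ e V)
        + v * φ (star (FreeAlgebra.lift ℂ e U) * FreeAlgebra.lift ℂ e
            (annih x (φ ∘ₗ (FreeAlgebra.lift ℂ e).toLinearMap) V)) := by
  obtain ⟨U', e', hU'⟩ := exists_formal_star e σ hσ x hx U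
  have hφ : conjDual φ = φ := by ext a; simp [hstar]
  have h2 := hU' φ (φ ∘ₗ LinearMap.mulLeft ℂ (FreeAlgebra.lift ℂ e V))
  have b : (φ ∘ₗ (FreeAlgebra.lift ℂ e).toLinearMap) ∘ₗ LinearMap.mulLeft ℂ V
      = (φ ∘ₗ LinearMap.mulLeft ℂ (FreeAlgebra.lift ℂ e V))
        ∘ₗ (FreeAlgebra.lift ℂ e).toLinearMap := by
    ext W; simp
  rw [hφ] at h2
  have h3 := h (V * U')
  rw [annih_mul, b, map_add] at h3
  simp only [LinearMap.comp_apply, AlgHom.toLinearMap_apply, map_mul, FreeAlgebra.lift_ι_apply,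
    e', h2, conjDual_apply, LinearMap.mulLeft_apply, star_star] at h3
  rw [htr, mul_assoc, h3, mul_add, add_comm, htr (FreeAlgebra.lift ℂ e V), htr (star _)]
  rw [htr (star (FreeAlgebra.lift ℂ e U))]

end Adjoint

/-! ### Quadratic sums of creation and annihilation operators -/

section Fock

open scoped InnerProductSpace

variable {E : Type*} [SeminormedAddCommGroup E] [InnerProductSpace ℂ E] {ι : Type*} [Fintype ι]
  [DecidableEq ι]

/-- The operators `l i` with adjoints `l i⋆ = l' i` are free creation operators with covariance `v`:
`l i⋆ (l j x) = δᵢⱼ v i x`. The space may have null vectors. -/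
structure IsCreation (v : ι → ℝ≥0) (l l' : ι → E →ₗ[ℂ] E) : Prop where
  adjoint : ∀ i x y, ⟪l i x, y⟫_ℂ = ⟪x, l' i y⟫_ℂ
  relation : ∀ i j x, l' i (l j x) = if i = j then (v i : ℂ) • x else 0

variable {v : ι → ℝ≥0} {l l' : ι → E →ₗ[ℂ] E}

theorem IsCreation.norm_sum_sq (h : IsCreation v l l') (u : ι → E) :
    ‖∑ i, l i (u i)‖ ^ 2 = ∑ i, v i * ‖u i‖ ^ 2 := by
  have : ⟪∑ i, l i (u i), ∑ i, l i (u i)⟫_ℂ = ∑ i, (v i : ℂ) * ⟪u i, u i⟫_ℂ := by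
    rw [sum_inner]
    refine Finset.sum_congr rfl fun i _ => ?_
    rw [h.adjoint, map_sum, ← inner_smul_right]
    simp [h.relation]
  simp only [inner_self_eq_norm_sq_to_K] at this
  apply Complex.ofReal_injective
  push_cast
  exact this

/-- The operator `∑ l i ∘ a ∘ l i` is small: its square norm at `x` is
`∑ v i ‖a (l i x)‖² = re β ∑ (v i)² ‖x‖²`. -/
theorem IsCreation.norm_sum_create_le (h : IsCreation v l l') {δ K : ℝ} (hδ : ∀ i, (v i : ℝ) ≤ δ)
    {a a' : E →ₗ[ℂ] E} (ha : ∀ x y, ⟪a x, y⟫_ℂ = ⟪x, a' y⟫_ℂ) {β : ℂ} (hβ : ‖β‖ ≤ K ^ 2)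
    (hrel : ∀ i x, l' i (a' (a (l i x))) = ((v i : ℂ) * β) • x) (hK : 0 ≤ K) (x : E) :
    ‖∑ i, l i (a (l i x))‖ ≤ √(δ * ∑ i, (v i : ℝ)) * K * ‖x‖ := by
  have h1 : ∀ i, ‖a (l i x)‖ ^ 2 ≤ v i * (K ^ 2 * ‖x‖ ^ 2) := by
    intro i
    have : ⟪a (l i x), a (l i x)⟫_ℂ = ((v i : ℂ) * β) * ⟪x, x⟫_ℂ := by
      rw [ha, h.adjoint, hrel, inner_smul_right]
    have h2 := congrArg norm this
    rw [inner_self_eq_norm_sq_to_K, inner_self_eq_norm_sq_to_K, norm_mul, norm_mul] at h2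
    simp at h2
    rw [h2, mul_assoc]
    gcongr
  have h0 : 0 ≤ δ * ∑ i, (v i : ℝ) := by
    rw [Finset.mul_sum]
    exact Finset.sum_nonneg fun i _ => mul_nonneg ((v i).2.trans (hδ i)) (v i).2
  refine le_of_sq_le_sq ?_ (by positivity)
  rw [h.norm_sum_sq, mul_pow, mul_pow, Real.sq_sqrt h0, Finset.mul_sum, Finset.sum_mul,
    Finset.sum_mul]
  refine Finset.sum_le_sum fun i _ => ?_
  calc (v i : ℝ) * ‖a (l i x)‖ ^ 2 ≤ v i * (v i * (K ^ 2 * ‖x‖ ^ 2)) := by gcongr; exact h1 i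
    _ ≤ δ * (v i * (K ^ 2 * ‖x‖ ^ 2)) := by gcongr; exact hδ i
    _ = _ := by ring

/-- The operator `∑ l i⋆ ∘ a⋆ ∘ l i⋆` is the adjoint of `∑ l i ∘ a ∘ l i`. -/
theorem IsCreation.norm_sum_annihilate_le (h : IsCreation v l l') {δ K : ℝ}
    (hδ : ∀ i, (v i : ℝ) ≤ δ)
    {a a' : E →ₗ[ℂ] E} (ha : ∀ x y, ⟪a x, y⟫_ℂ = ⟪x, a' y⟫_ℂ) {β : ℂ} (hβ : ‖β‖ ≤ K ^ 2)
    (hrel : ∀ i x, l' i (a' (a (l i x))) = ((v i : ℂ) * β) • x) (hK : 0 ≤ K) (x : E) :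
    ‖∑ i, l' i (a' (l' i x))‖ ≤ √(δ * ∑ i, (v i : ℝ)) * K * ‖x‖ := by
  set y := ∑ i, l' i (a' (l' i x)) with hy
  have h1 : ⟪y, y⟫_ℂ = ⟪∑ i, l i (a (l i y)), x⟫_ℂ := by
    conv_lhs => rw [hy, inner_sum, ← hy]
    rw [sum_inner]
    exact Finset.sum_congr rfl fun i _ => by rw [h.adjoint, ha, h.adjoint]
  have h2 : ‖y‖ * ‖y‖ ≤ (√(δ * ∑ i, (v i : ℝ)) * K * ‖x‖) * ‖y‖ := by
    calc ‖y‖ * ‖y‖ = ‖⟪y, y⟫_ℂ‖ := by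
          rw [inner_self_eq_norm_sq_to_K]; simp [sq]
      _ ≤ ‖∑ i, l i (a (l i y))‖ * ‖x‖ := by rw [h1]; exact norm_inner_le_norm _ _
      _ ≤ (√(δ * ∑ i, (v i : ℝ)) * K * ‖y‖) * ‖x‖ := by
        gcongr; exact h.norm_sum_create_le hδ ha hβ hrel hK y
      _ = _ := by ring
  rcases (norm_nonneg y).eq_or_lt with h0 | h0
  · rw [← h0]; positivity
  · exact le_of_mul_le_mul_right h2 h0

/-- A form of Bessel's inequality, written without division since some `v i` may be zero. -/
theorem IsCreation.sum_norm_annihilate_sq_le (h : IsCreation v l l') {δ : ℝ} (hδ0 : 0 < δ)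
    (hδ : ∀ i, (v i : ℝ) ≤ δ) (x : E) :
    ∑ i, v i * ‖l' i x‖ ^ 2 ≤ δ ^ 2 * ‖x‖ ^ 2 := by
  set Q := ∑ i, v i * ‖l' i x‖ ^ 2 with hQ
  set y := ∑ i, l i ((v i : ℂ) • l' i x) with hy
  have h1 : RCLike.re ⟪y, x⟫_ℂ = Q := by
    rw [hy, sum_inner, map_sum]
    refine Finset.sum_congr rfl fun i _ => ?_
    rw [h.adjoint, inner_smul_left, inner_self_eq_norm_sq_to_K]
    simp [← Complex.ofReal_pow]
  have h2 : ‖y‖ ^ 2 ≤ δ ^ 2 * Q := by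
    rw [hy, h.norm_sum_sq, hQ, Finset.mul_sum]
    refine Finset.sum_le_sum fun i _ => ?_
    rw [norm_smul, mul_pow, mul_left_comm]
    have : ‖(v i : ℂ)‖ = v i := by simp
    rw [this]
    gcongr
    exact hδ i
  have h3 := norm_sub_sq (𝕜 := ℂ) y (((δ ^ 2 : ℝ) : ℂ) • x)
  have h6 : RCLike.re (((δ ^ 2 : ℝ) : ℂ) * ⟪y, x⟫_ℂ) = δ ^ 2 * Q := by
    rw [← h1]; exact Complex.re_ofReal_mul _ _
  rw [inner_smul_right, h6, norm_smul, Complex.norm_real, Real.norm_of_nonneg (by positivity)] at h3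
  have h4 := sq_nonneg ‖y - ((δ ^ 2 : ℝ) : ℂ) • x‖
  have h5 : δ ^ 2 * Q ≤ δ ^ 2 * (δ ^ 2 * ‖x‖ ^ 2) := by nlinarith
  exact le_of_mul_le_mul_left h5 (by positivity)

theorem IsCreation.norm_sum_preserve_le (h : IsCreation v l l') {δ K : ℝ} (hδ0 : 0 < δ)
    (hδ : ∀ i, (v i : ℝ) ≤ δ) {a : E →ₗ[ℂ] E} (hK : 0 ≤ K) (ha : ∀ x, ‖a x‖ ≤ K * ‖x‖) (x : E) :
    ‖∑ i, l i (a (l' i x))‖ ≤ δ * K * ‖x‖ := by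
  refine le_of_sq_le_sq ?_ (by positivity)
  rw [h.norm_sum_sq]
  calc ∑ i, v i * ‖a (l' i x)‖ ^ 2 ≤ ∑ i, K ^ 2 * (v i * ‖l' i x‖ ^ 2) := by
        refine Finset.sum_le_sum fun i _ => ?_
        rw [mul_left_comm, ← mul_pow]
        gcongr
        exact ha _
    _ ≤ K ^ 2 * (δ ^ 2 * ‖x‖ ^ 2) := by
        rw [← Finset.mul_sum]; gcongr; exact h.sum_norm_annihilate_sq_le hδ0 hδ x
    _ = _ := by ring

/-- In the expansion of `∑ (l i + l i⋆) ∘ a ∘ (l i + l i⋆)` the terms `l i⋆ ∘ a ∘ l i` sum to the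
scalar `γ ∑ v i`, and the other three sums are small. -/
theorem IsCreation.norm_quadratic_sum_sub_le (h : IsCreation v l l') {δ K : ℝ} (hδ0 : 0 < δ)
    (hδ : ∀ i, (v i : ℝ) ≤ δ) {a a' : E →ₗ[ℂ] E} (ha : ∀ x y, ⟪a x, y⟫_ℂ = ⟪x, a' y⟫_ℂ)
    (hK : 0 ≤ K) (haK : ∀ x, ‖a x‖ ≤ K * ‖x‖) {β β' γ : ℂ} (hβ : ‖β‖ ≤ K ^ 2)
    (hβ' : ‖β'‖ ≤ K ^ 2) (hrel : ∀ i x, l' i (a' (a (l i x))) = ((v i : ℂ) * β) • x)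
    (hrel' : ∀ i x, l' i (a (a' (l i x))) = ((v i : ℂ) * β') • x)
    (hγ : ∀ i x, l' i (a (l i x)) = ((v i : ℂ) * γ) • x) (x : E) :
    ‖∑ i, (l i + l' i) (a ((l i + l' i) x)) - (γ * ∑ i, (v i : ℂ)) • x‖
      ≤ (δ + 2 * √(δ * ∑ i, (v i : ℝ))) * K * ‖x‖ := by
  have ha' : ∀ x y, ⟪a' x, y⟫_ℂ = ⟪x, a y⟫_ℂ := fun x y => by
    rw [← inner_conj_symm, ← ha, inner_conj_symm]
  have e : ∑ i, (l i + l' i) (a ((l i + l' i) x)) - (γ * ∑ i, (v i : ℂ)) • x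
      = ∑ i, l i (a (l' i x)) + ∑ i, l i (a (l i x)) + ∑ i, l' i (a (l' i x)) := by
    have : (γ * ∑ i, (v i : ℂ)) • x = ∑ i, l' i (a (l i x)) := by
      rw [Finset.mul_sum, Finset.sum_smul]
      exact Finset.sum_congr rfl fun i _ => by rw [hγ, mul_comm]
    rw [this, ← Finset.sum_sub_distrib, ← Finset.sum_add_distrib, ← Finset.sum_add_distrib]
    refine Finset.sum_congr rfl fun i _ => ?_
    simp only [LinearMap.add_apply, map_add]
    abel
  rw [e]
  refine (norm_add₃_le).trans ?_
  have h1 := h.norm_sum_preserve_le hδ0 hδ hK haK x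
  have h2 := h.norm_sum_create_le hδ ha hβ hrel hK x
  have h3 := h.norm_sum_annihilate_le hδ ha' hβ' hrel' hK x
  linarith

end Fock

/-! ### Faithful states on C⋆-algebras -/

section State

variable {A : Type*} [CStarAlgebra A]

theorem re_map_conj_nonneg [PartialOrder A] [StarOrderedRing A] {φ : A →ₗ[ℂ] ℂ}
    (hre : ∀ x, 0 ≤ (φ (star x * x)).re) {z : A} (hz : 0 ≤ z) (b : A) :
    0 ≤ (φ (star b * z * b)).re := by
  obtain ⟨y, rfl⟩ := CStarAlgebra.nonneg_iff_eq_star_mul_self.mp hz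
  simpa [mul_assoc] using hre (y * b)

/-- Left multiplication by `a` is bounded by `‖a‖` in the seminorm of a positive functional. -/
theorem re_map_star_mul_le {φ : A →ₗ[ℂ] ℂ} (hre : ∀ x, 0 ≤ (φ (star x * x)).re) (a b : A) :
    (φ (star (a * b) * (a * b))).re ≤ ‖a‖ ^ 2 * (φ (star b * b)).re := by
  let _ := CStarAlgebra.spectralOrder A
  let _ := CStarAlgebra.spectralOrderedRing A
  have h := re_map_conj_nonneg hre
    (sub_nonneg.2 (CStarAlgebra.star_mul_le_algebraMap_norm_sq (a := a))) b
  have e : φ (star b * (algebraMap ℝ A (‖a‖ ^ 2) - star a * a) * b)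
      = ((‖a‖ ^ 2 : ℝ) : ℂ) * φ (star b * b) - φ (star (a * b) * (a * b)) := by
    rw [mul_sub, sub_mul, map_sub, Algebra.algebraMap_eq_smul_one, mul_smul_comm, mul_one,
      smul_mul_assoc, ← Complex.coe_smul, map_smul, smul_eq_mul]
    simp only [star_mul, mul_assoc]
  rw [e, Complex.sub_re, Complex.re_ofReal_mul] at h
  linarith

/-- For a faithful state, the growth of the moments of a positive element bounds its norm: if
`D < D' < ‖x‖`, then `g(x) = (x - D')₊` is not zero, but `g(x)²` is dominated by the multiple
`‖x‖² / D' ^ (2 q)` of `x ^ (2 q)`, whose trace tends to zero. -/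
theorem norm_le_of_moments_le [PartialOrder A] [StarOrderedRing A] {φ : A →ₗ[ℂ] ℂ}
    (hre : ∀ x, 0 ≤ (φ (star x * x)).re) (him : ∀ x, (φ (star x * x)).im = 0)
    (hfaith : ∀ x, φ (star x * x) = 0 → x = 0) {x : A} (hx : 0 ≤ x) {D : ℝ} (hD : 0 ≤ D)
    (h : ∀ q : ℕ, (φ (x ^ (2 * q))).re ≤ D ^ (2 * q)) : ‖x‖ ≤ D := by
  by_contra! hlt
  have : Nontrivial A := ⟨x, 0, fun h0 => by rw [h0, norm_zero] at hlt; linarith⟩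
  obtain ⟨D', hD1, hD2⟩ := exists_between hlt
  have hD'0 : 0 < D' := hD.trans_lt hD1
  have hsa : IsSelfAdjoint x := .of_nonneg hx
  let g : ℝ → ℝ := fun t => max (t - D') 0
  have hg : Continuous g := by fun_prop
  have hmono : ∀ q : ℕ, cfc (fun t => g t * g t) x ≤ (‖x‖ ^ 2 / D' ^ (2 * q)) • x ^ (2 * q) := by
    intro q
    rw [← cfc_pow_id (R := ℝ) x (2 * q),
      ← cfc_smul (R := ℝ) (‖x‖ ^ 2 / D' ^ (2 * q)) (fun t : ℝ => t ^ (2 * q)) x]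
    refine cfc_mono fun t ht => ?_
    have ht0 : 0 ≤ t := spectrum_nonneg_of_nonneg hx ht
    have htx : t ≤ ‖x‖ := (Real.le_norm_self t).trans (spectrum.norm_le_norm_of_mem ht)
    simp only [g, smul_eq_mul]
    rcases le_total t D' with hle | hle
    · rw [max_eq_right (by linarith)]
      have := (even_two_mul q).pow_nonneg t
      rw [mul_zero]; positivity
    · rw [max_eq_left (by linarith), div_mul_eq_mul_div, mul_div_assoc]
      have h1 : 1 ≤ t ^ (2 * q) / D' ^ (2 * q) := by
        rw [one_le_div (by positivity)]
        gcongr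
      calc (t - D') * (t - D') ≤ ‖x‖ * ‖x‖ := by
            gcongr <;> linarith
        _ = ‖x‖ ^ 2 * 1 := by ring
        _ ≤ _ := by gcongr
  have hsq : cfc (fun t => g t * g t) x = star (cfc g x) * cfc g x := by
    rw [cfc_mul g g x, (cfc_predicate g x : IsSelfAdjoint _).star_eq]
  have hbound : ∀ q : ℕ, (φ (star (cfc g x) * cfc g x)).re ≤ ‖x‖ ^ 2 * ((D / D') ^ 2) ^ q := by
    intro q
    have h1 := re_map_conj_nonneg hre (sub_nonneg.2 (hmono q)) 1
    rw [star_one, one_mul, mul_one, map_sub, ← Complex.coe_smul, map_smul, smul_eq_mul,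
      Complex.sub_re, Complex.re_ofReal_mul, hsq, sub_nonneg] at h1
    refine h1.trans ?_
    calc ‖x‖ ^ 2 / D' ^ (2 * q) * (φ (x ^ (2 * q))).re
        ≤ ‖x‖ ^ 2 / D' ^ (2 * q) * D ^ (2 * q) := by gcongr; exact h q
      _ = _ := by rw [← pow_mul, div_pow]; ring
  have hlim : Filter.Tendsto (fun q : ℕ => ‖x‖ ^ 2 * ((D / D') ^ 2) ^ q) Filter.atTop (nhds 0) := by
    have h1 : (D / D') ^ 2 < 1 := by
      have : D / D' < 1 := (div_lt_one hD'0).2 hD1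
      have : 0 ≤ D / D' := by positivity
      nlinarith
    simpa using (tendsto_pow_atTop_nhds_zero_of_lt_one (by positivity) h1).const_mul (‖x‖ ^ 2)
  have hzero : (φ (star (cfc g x) * cfc g x)).re = 0 :=
    le_antisymm (ge_of_tendsto' hlim hbound) (hre _)
  have hg0 : cfc g x = 0 := hfaith _ (Complex.ext hzero (him _))
  rw [← cfc_zero (R := ℝ) (a := x)] at hg0
  have := (cfc_eq_cfc_iff_eqOn (R := ℝ) (a := x) (f := g) (g := 0) hsa hg.continuousOn).1 hg0
    (CStarAlgebra.norm_mem_spectrum_of_nonneg hx)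
  simp only [g, Pi.zero_apply] at this
  have := le_max_left (‖x‖ - D') 0
  linarith

/-- A positive functional is self-adjoint (polarization). -/
theorem map_star_eq_star_map {φ : A →ₗ[ℂ] ℂ} (him : ∀ x, (φ (star x * x)).im = 0) (a : A) :
    φ (star a) = star (φ a) := by
  -- the imaginary parts of `φ ((1 + a)* (1 + a))` and `φ ((1 + i a)* (1 + i a))`
  have h1 := him (1 + a)
  have h2 := him (1 + Complex.I • a)
  have h3 := him a
  have h4 := him 1
  simp only [star_add, star_one, add_mul, mul_add, one_mul, mul_one, map_add, star_smul,
    map_smul, smul_mul_assoc, mul_smul_comm, Complex.add_im, smul_eq_mul, h3, star_one,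
    Complex.star_def, Complex.conj_I, Complex.mul_im, Complex.neg_re, Complex.neg_im, Complex.I_re,
    Complex.I_im] at h1 h2 h4
  apply Complex.ext
  · simp only [Complex.star_def, Complex.conj_re]
    simp at h2 h4
    linarith
  · simp only [Complex.star_def, Complex.conj_im]
    linarith

end State

/-! ### The norm estimate for quadratic sums of free increments -/

section CreateAnnihilate

variable {α : Type*} [DecidableEq α]

/-- The relation `l x⋆ ∘ P ∘ l y = δ v f(P)` between annihilation and creation operators, up to the
factor `v` in `l x⋆ = v • annih x f`. The element `P` does not involve the letters `x` and `y`. -/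
theorem SchwingerDyson.annih_mul_create {f : Module.Dual ℂ (FreeAlgebra ℂ α)}
    (htr : ∀ U V, f (U * V) = f (V * U)) {x y : α} {w : ℂ} (hy : SchwingerDyson f y w)
    {P : FreeAlgebra ℂ α} (hx : ∀ ψ, annih x ψ P = 0) (hyP : ∀ ψ, annih y ψ P = 0)
    (U : FreeAlgebra ℂ α) :
    annih x f (P * (FreeAlgebra.ι ℂ y * U - w • annih y f U)) = if y = x then f P • U else 0 := by
  have e : (f ∘ₗ LinearMap.mulLeft ℂ P) ∘ₗ LinearMap.mulLeft ℂ (FreeAlgebra.ι ℂ y)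
      = w • ((f ∘ₗ LinearMap.mulLeft ℂ P) ∘ₗ annih y f) := by
    ext Y
    simp only [LinearMap.comp_apply, LinearMap.mulLeft_apply, LinearMap.smul_apply, smul_eq_mul]
    rw [htr, mul_assoc, hy, annih_mul, hyP, add_zero, htr]
  rw [annih_mul, hx, zero_mul, zero_add, map_sub, annih_mul, annih_ι, e, annih_dual_smul,
    map_smul, annih_annih, add_sub_cancel_right]
  split_ifs <;> simp

end CreateAnnihilate

section Main

variable {A : Type*} [CStarAlgebra A]

/-- The inner product `φ (g(U)⋆ g(V))` on an algebra `R` that a state `φ` induces along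
`g : R → A`. It is in general degenerate. -/
@[reducible]
noncomputable def stateCore {φ : A →ₗ[ℂ] ℂ} (hre : ∀ x, 0 ≤ (φ (star x * x)).re)
    (hstar : ∀ a, φ (star a) = star (φ a)) {R : Type*} [Ring R] [Algebra ℂ R] (g : R →ₐ[ℂ] A) :
    PreInnerProductSpace.Core ℂ R where
  inner U V := φ (star (g U) * g V)
  conj_inner_symm U V := by
    have := hstar (star (g V) * g U)
    rw [star_mul, star_star] at this
    rw [this]; rfl
  re_inner_nonneg U := hre (g U)
  add_left U V W := by simp [add_mul]
  smul_left U V c := by simp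

/-- If `T` and its adjoint are bounded by `C` in the seminorm of a faithful state on a subalgebra
that contains them, dense or not, then `‖T‖ ≤ C` in operator norm. -/
theorem norm_le_of_seminorm_le {φ : A →ₗ[ℂ] ℂ} (h1 : φ 1 = 1)
    (hre : ∀ x, 0 ≤ (φ (star x * x)).re) (him : ∀ x, (φ (star x * x)).im = 0)
    (hfaith : ∀ x, φ (star x * x) = 0 → x = 0) {R : Type*} [Ring R] [Algebra ℂ R] (g : R →ₐ[ℂ] A)
    (T T' : R) (hT : g T' = star (g T)) {C : ℝ} (hC : 0 ≤ C)
    (hb : ∀ U, (φ (star (g (T * U)) * g (T * U))).re ≤ C ^ 2 * (φ (star (g U) * g U)).re)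
    (hb' : ∀ U, (φ (star (g (T' * U)) * g (T' * U))).re ≤ C ^ 2 * (φ (star (g U) * g U)).re) :
    ‖g T‖ ≤ C := by
  let _ := CStarAlgebra.spectralOrder A
  let _ := CStarAlgebra.spectralOrderedRing A
  have hsq : ‖star (g T) * g T‖ ≤ C ^ 2 := by
    refine norm_le_of_moments_le hre him hfaith (star_mul_self_nonneg (g T)) (by positivity) ?_
    have hpow : ∀ q : ℕ,
        (φ (star (g ((T' * T) ^ q)) * g ((T' * T) ^ q))).re ≤ (C ^ 2) ^ (2 * q) := by
      intro q
      induction q with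
      | zero => simp [h1]
      | succ q ih =>
        calc _ = (φ (star (g (T' * (T * (T' * T) ^ q))) * g (T' * (T * (T' * T) ^ q)))).re := by
              rw [pow_succ', mul_assoc]
          _ ≤ C ^ 2 * (C ^ 2 * (C ^ 2) ^ (2 * q)) :=
              (hb' _).trans (by gcongr; exact (hb _).trans (by gcongr))
          _ = _ := by ring
    intro q
    have hs : star ((star (g T) * g T) ^ q) = (star (g T) * g T) ^ q := by
      rw [star_pow, star_mul, star_star]
    have := hpow q
    rw [map_pow g, map_mul g, hT, hs, ← pow_add, ← two_mul] at this
    exact this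
  rw [CStarRing.norm_star_mul_self, ← sq] at hsq
  exact le_of_sq_le_sq hsq hC

/-- The quadratic sum of free semicircular increments around `a` differs from `φ a • ∑ v i` by at
most a multiple of `√δ` for small `δ`, where `δ` bounds the variances. -/
theorem norm_quadratic_variation_le {φ : A →ₗ[ℂ] ℂ} (h1 : φ 1 = 1)
    (hre : ∀ x, 0 ≤ (φ (star x * x)).re) (him : ∀ x, (φ (star x * x)).im = 0)
    (hfaith : ∀ x, φ (star x * x) = 0 → x = 0) (htr : ∀ a b, φ (a * b) = φ (b * a))
    {n : ℕ} (a : A) (X : Fin n → A) (hXsa : ∀ i, star (X i) = X i) (v : Fin n → ℝ≥0)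
    (B : Fin n → Subalgebra ℂ A) (haB : ∀ i, a ∈ B i) (haB' : ∀ i, star a ∈ B i)
    (hXB : ∀ i j, j < i → X j ∈ B i)
    (hX : ∀ i, X i = 0 ∧ v i = 0 ∨ v i ≠ 0 ∧ FreeFrom φ (X i) (B i) ∧
      HasDistribution φ (X i) (semicircle (v i))) {δ : ℝ} (hδ0 : 0 < δ)
    (hδ : ∀ i, (v i : ℝ) ≤ δ) :
    ‖∑ i, X i * a * X i - (φ a * ∑ i, (v i : ℂ)) • (1 : A)‖
      ≤ (δ + 2 * √(δ * ∑ i, (v i : ℝ))) * ‖a‖ := by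
  have hstar := map_star_eq_star_map him
  -- `FreeAlgebra ℂ (Bool ⊕ Fin n)`: the letters `true`, `false` stand for `a` and `star a`
  let e : Bool ⊕ Fin n → A := Sum.elim (fun b => bif b then a else star a) X
  let g := FreeAlgebra.lift ℂ e
  let f : Module.Dual ℂ (FreeAlgebra ℂ (Bool ⊕ Fin n)) := φ ∘ₗ g.toLinearMap
  have hftr : ∀ U V, f (U * V) = f (V * U) := fun U V => by simp [f, htr]
  have hSD : ∀ i, SchwingerDyson f (Sum.inr i) (v i) :=
    schwingerDyson_of_sequentially_free h1 htr _ X v B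
      (fun b i => by cases b; exacts [haB' i, haB i]) hXB hX
  let _cd : PreInnerProductSpace.Core ℂ (FreeAlgebra ℂ (Bool ⊕ Fin n)) := stateCore hre hstar g
  let _ : SeminormedAddCommGroup (FreeAlgebra ℂ (Bool ⊕ Fin n)) :=
    @InnerProductSpace.Core.toSeminormedAddCommGroup ℂ _ _ _ _ _cd
  let _ : InnerProductSpace ℂ (FreeAlgebra ℂ (Bool ⊕ Fin n)) := InnerProductSpace.ofCore _cd
  have hinner : ∀ U V : FreeAlgebra ℂ (Bool ⊕ Fin n), inner ℂ U V = φ (star (g U) * g V) :=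
    fun _ _ => rfl
  have hnorm : ∀ U : FreeAlgebra ℂ (Bool ⊕ Fin n), ‖U‖ ^ 2 = (φ (star (g U) * g U)).re :=
      fun U => by
    rw [← hinner]; exact (inner_self_eq_norm_sq (𝕜 := ℂ) U).symm
  let x : Fin n → FreeAlgebra ℂ (Bool ⊕ Fin n) := fun i => FreeAlgebra.ι ℂ (Sum.inr i)
  let c : Bool → FreeAlgebra ℂ (Bool ⊕ Fin n) := fun b => FreeAlgebra.ι ℂ (Sum.inl b)
  let l' : Fin n → FreeAlgebra ℂ (Bool ⊕ Fin n) →ₗ[ℂ] FreeAlgebra ℂ (Bool ⊕ Fin n) :=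
    fun i => (v i : ℂ) • annih (Sum.inr i) f
  let l : Fin n → FreeAlgebra ℂ (Bool ⊕ Fin n) →ₗ[ℂ] FreeAlgebra ℂ (Bool ⊕ Fin n) :=
    fun i => LinearMap.mulLeft ℂ (x i) - l' i
  have hgc : ∀ b, g (c b) = bif b then a else star a := fun b => by simp [g, c, e]
  have hrel : ∀ P, (∀ i ψ, annih (Sum.inr i) ψ P = 0) → ∀ i j U,
      l' i (P * l j U) = if i = j then ((v i : ℂ) * f P) • U else 0 := by
    intro P hP i j U
    have := (hSD j).annih_mul_create hftr (hP i) (hP j) U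
    simp only [l', l, LinearMap.smul_apply, LinearMap.sub_apply, LinearMap.mulLeft_apply, x]
    rw [this]
    simp only [Sum.inr.injEq, eq_comm (a := j)]
    split_ifs <;> simp [mul_smul]
  have hcP : ∀ b i ψ, annih (Sum.inr i) ψ (c b) = 0 := fun b i ψ => by simp [c, annih_ι]
  have hcr : IsCreation v l l' := by
    refine ⟨fun i U V => ?_, fun i j U => ?_⟩
    · have := (hSD i).adjoint htr hstar e (Sum.map not id)
        (by rintro (b | j); · cases b <;> simp [e]
            · simp [e, hXsa]) (Sum.inr i) (by rintro (b | j) <;> simp) V U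
      have h2 := (hSD i).adjoint htr hstar e (Sum.map not id)
        (by rintro (b | j); · cases b <;> simp [e]
            · simp [e, hXsa]) (Sum.inr i) (by rintro (b | j) <;> simp) U V
      rw [hinner, hinner]
      simp only [l, l', x, LinearMap.sub_apply, LinearMap.mulLeft_apply, map_sub, map_mul, star_sub,
        star_mul, sub_mul, LinearMap.smul_apply, map_smul, star_smul, smul_mul_assoc,
        mul_smul_comm, smul_eq_mul]
      simp only [g, FreeAlgebra.lift_ι_apply]
      have hx : star (e (Sum.inr i)) = e (Sum.inr i) := hXsa i
      rw [hx, mul_assoc]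
      refine (congrArg (· - _) h2).trans ?_
      simp [f, g]
    · simpa [f, h1] using hrel 1 (by simp) i j U
  have hadj : ∀ b, ∀ U V : FreeAlgebra ℂ (Bool ⊕ Fin n),
      inner ℂ (LinearMap.mulLeft ℂ (c b) U) V = inner ℂ U (LinearMap.mulLeft ℂ (c (!b)) V) := by
    intro b U V
    rw [hinner, hinner]
    simp only [LinearMap.mulLeft_apply, map_mul, hgc]
    cases b <;> simp [mul_assoc]
  have hbd : ∀ b, ∀ U : FreeAlgebra ℂ (Bool ⊕ Fin n),
      ‖LinearMap.mulLeft ℂ (c b) U‖ ≤ ‖a‖ * ‖U‖ := by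
    intro b U
    refine le_of_sq_le_sq ?_ (by positivity)
    rw [mul_pow, hnorm, hnorm, LinearMap.mulLeft_apply, map_mul g]
    refine (re_map_star_mul_le hre _ _).trans_eq ?_
    rw [hgc]
    cases b <;> simp
  have hcc : ∀ b i ψ, annih (Sum.inr i) ψ (c b * c (!b)) = 0 := fun b i ψ => by
    rw [annih_mul, hcP, hcP]; simp
  have hβ : ∀ b, ‖f (c b * c (!b))‖ ≤ ‖a‖ ^ 2 := by
    intro b
    have h2 := re_map_star_mul_le hre (g (c (!b))) 1
    have h3 : star (g (c (!b)) * 1) * (g (c (!b)) * 1) = g (c b * c (!b)) := by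
      rw [map_mul, hgc, hgc]; cases b <;> simp
    have h4 : star (g (c (!b))) * (g (c (!b))) = g (c b * c (!b)) := by
      rw [map_mul, hgc, hgc]; cases b <;> simp
    have h5 : f (c b * c (!b)) = (((f (c b * c (!b))).re : ℝ) : ℂ) := by
      apply Complex.ext
      · simp
      · have := him (g (c (!b)))
        rw [h4] at this
        simpa [f] using this
    have h6 : 0 ≤ (f (c b * c (!b))).re := by
      have := hre (g (c (!b)))
      rwa [h4] at this
    rw [h3, star_one, one_mul, h1, Complex.one_re, mul_one, hgc] at h2
    rw [h5, Complex.norm_real, Real.norm_of_nonneg h6]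
    refine h2.trans_eq ?_
    cases b <;> simp
  have hmain : ∀ b U, ‖(∑ i, x i * c b * x i - (f (c b) * ∑ i, (v i : ℂ)) • 1) * U‖
      ≤ ((δ + 2 * √(δ * ∑ i, (v i : ℝ))) * ‖a‖) * ‖U‖ := by
    intro b U
    have := hcr.norm_quadratic_sum_sub_le hδ0 hδ (a := LinearMap.mulLeft ℂ (c b))
      (a' := LinearMap.mulLeft ℂ (c (!b)))
      (hadj b) (norm_nonneg a) (hbd b) (hβ (!b)) (hβ b) (γ := f (c b))
      (fun i U => by simpa [mul_assoc] using hrel (c (!b) * c b) (by simpa using hcc (!b)) i i U)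
      (fun i U => by simpa [mul_assoc] using hrel (c b * c (!b)) (hcc b) i i U)
      (fun i U => by simpa using hrel (c b) (hcP b) i i U) U
    convert this using 2
    simp [l, sub_mul, Finset.sum_mul, mul_assoc]
  have hC : 0 ≤ (δ + 2 * √(δ * ∑ i, (v i : ℝ))) * ‖a‖ := by positivity
  have hmain' : ∀ b U, (φ (star (g ((∑ i, x i * c b * x i - (f (c b) * ∑ i, (v i : ℂ)) • 1) * U))
        * g ((∑ i, x i * c b * x i - (f (c b) * ∑ i, (v i : ℂ)) • 1) * U))).re
      ≤ ((δ + 2 * √(δ * ∑ i, (v i : ℝ))) * ‖a‖) ^ 2 * (φ (star (g U) * g U)).re := by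
    intro b U
    rw [← hnorm, ← hnorm, ← mul_pow]
    gcongr
    exact hmain b U
  -- the two values of the Boolean give the operator and its adjoint
  have := norm_le_of_seminorm_le h1 hre him hfaith g _ _ ?_ hC (hmain' true) (hmain' false)
  · simpa [g, x, c, e, f] using this
  · simp [g, x, c, e, f, hXsa, mul_assoc, hstar, star_smul]

end Main

end FreeCalculus

theorem theorem3p11 {H : Type*} [NormedAddCommGroup H] [InnerProductSpace ℂ H] [CompleteSpace H]
    (M : VonNeumannAlgebra H) (τ : M.toStarSubalgebra →ₗ[ℂ] ℂ)
    (F : ℝ≥0 → VonNeumannAlgebra H) (S : ℝ≥0 → M.toStarSubalgebra)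
    (hS : FreeCalculus.IsFreeBrownianMotion M τ F S)
    (a b : ℝ≥0) (hab : a ≤ b)
    (A : M.toStarSubalgebra) (hA : (A : H →L[ℂ] H) ∈ F a) :
    ∀ ε : ℝ, 0 < ε → ∃ δ : ℝ, 0 < δ ∧
      ∀ (n : ℕ) (t : Fin (n + 1) → ℝ≥0), Monotone t → t 0 = a → t (Fin.last n) = b →
        (∀ i : Fin n, (t i.succ : ℝ) - (t i.castSucc : ℝ) < δ) →
        ‖(∑ i : Fin n, (S (t i.succ) - S (t i.castSucc)) * A * (S (t i.succ) - S (t i.castSucc)))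
            - (τ A * (((b : ℝ) - (a : ℝ) : ℝ) : ℂ)) • (1 : M.toStarSubalgebra)‖ < ε := by
  have hclosed : IsClosed (M.toStarSubalgebra : Set (H →L[ℂ] H)) := by
    have h := Set.isClosed_centralizer (Set.centralizer M.carrier)
    rwa [M.centralizer_centralizer'] at h
  intro ε hε
  have hlim : Filter.Tendsto (fun δ : ℝ => (δ + 2 * √(δ * ((b : ℝ) - a))) * ‖A‖)
      (nhdsWithin 0 (Set.Ioi 0)) (nhds 0) := by
    refine tendsto_nhdsWithin_of_tendsto_nhds ?_
    have : Continuous fun δ : ℝ => (δ + 2 * √(δ * ((b : ℝ) - a))) * ‖A‖ := by fun_prop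
    simpa using this.tendsto 0
  obtain ⟨δ, hδε, hδ0⟩ := ((hlim.eventually_lt_const hε).and self_mem_nhdsWithin).exists
  refine ⟨δ, hδ0, fun n t ht ht0 htn hmesh => ?_⟩
  have hstep : ∀ i : Fin n, t i.castSucc ≤ t i.succ := fun i => ht (Fin.castSucc_lt_succ).le
  have hv : ∀ i : Fin n, ((t i.succ - t i.castSucc : ℝ≥0) : ℝ) = t i.succ - t i.castSucc :=
    fun i => NNReal.coe_sub (hstep i)
  have hsum : ∑ i : Fin n, ((t i.succ - t i.castSucc : ℝ≥0) : ℝ) = (b : ℝ) - a := by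
    simp only [hv, ← ht0, ← htn]
    have h1 := Fin.sum_univ_succ fun i => (t i : ℝ)
    have h2 := Fin.sum_univ_castSucc fun i => (t i : ℝ)
    rw [Finset.sum_sub_distrib]
    linarith
  have haF : ∀ i : Fin n, F a ≤ F (t i.castSucc) := fun i =>
    hS.filtration_mono _ _ (ht0 ▸ ht (Fin.zero_le _))
  have key := FreeCalculus.norm_quadratic_variation_le hS.state.map_one hS.state.re_nonneg
    hS.state.im_eq_zero hS.state.faithful hS.state.tracial A
    (fun i : Fin n => S (t i.succ) - S (t i.castSucc))
    (fun i => by rw [star_sub, hS.selfAdjoint, hS.selfAdjoint])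
    (fun i => t i.succ - t i.castSucc)
    (fun i => FreeCalculus.subalgebraIn M (F (t i.castSucc)))
    (fun i => haF i hA) (fun i => (star_mem (haF i hA) : star (A : H →L[ℂ] H) ∈ F (t i.castSucc)))
    (fun i j hij => by
      refine sub_mem ?_ ?_
      · exact hS.filtration_mono _ _ (ht (Fin.succ_le_castSucc_iff.2 hij)) (hS.adapted _)
      · exact hS.filtration_mono _ _ (ht (Fin.castSucc_le_castSucc_iff.2 hij.le)) (hS.adapted _))
    (fun i => by
      rcases (hstep i).eq_or_lt with h | h
      · exact Or.inl ⟨by rw [h, sub_self], by rw [h, tsub_self]⟩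
      · exact Or.inr ⟨(tsub_pos_of_lt h).ne', hS.increment_free _ _ h,
          hS.increment_distribution _ _ h⟩)
    hδ0 (fun i => by rw [hv]; exact (hmesh i).le)
  have hsum' : ∑ i : Fin n, ((t i.succ - t i.castSucc : ℝ≥0) : ℂ) = (((b : ℝ) - a : ℝ) : ℂ) := by
    rw [← hsum]; push_cast; rfl
  rw [hsum, hsum'] at key
  exact key.trans_lt hδε
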